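/- \textbf{Setting.} Let $F$ be a finite field of characteristic $2$, $\alpha\in F$ an element of multiplicative order at least $n$, $d$ an odd positive integer with $2d\le n$, and $t_0=d/2$. Let $\mathcal C$ be the (possibly shortened) narrow-sense binary BCH code of length $n$ and designed distance $d$: the set of $c=(c_0,\dots,c_{n-1})\in\mathrm{GF}(2)^n$ with $\sum_i c_i\alpha^{ij}=0$ for $j=1,\dots,d-1$. Let $t\ge 0$ be an integer with $$t<\frac{n-\sqrt{n(n-2d)}}{2},$$ let the multiplicity be $$m=\Big\lfloor \frac{t\,t_0}{t^2-n(t-t_0)}\Big\rfloor ,$$ or any other natural number $m$ (an "optimized" multiplicity) satisfying, with $P_y$ as below, $$-\frac{t-t_0}{2}\Big(P_y-\frac{2tm-t+t_0+\frac12}{2(t-t_0)}\Big)^2+\frac{(2tm-t+t_0+\frac12)^2}{8(t-t_0)}+tm>\frac{nm(m+1)}{2},$$ and let $P_y=\big\lfloor (tm+\tfrac14)/(t-t_0)\big\rfloor$. ($m$ and $P_y$ are used only if step 4 of the algorithm is reached, which implies $t>t_0$.) \textbf{Algorithm.} Input: a received word $r\in\mathrm{GF}(2)^n$. 1. Compute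 the syndromes $S_j=\sum_i r_i\alpha^{i(j+1)}$, $0\le j\le d-2$. 2. (Berlekamp algorithm.) Start with $\Lambda=1$, $x^2B=x$, $L_\Lambda=0$, $L_{x^2B}=1$. For $r=0,2,\dots,d-3$, put $\Delta=\sum_{i=0}^{L_\Lambda}\Lambda_iS_{r-i}$ and do simultaneously: replace $\Lambda$ by $\Lambda-\Delta\,x^2B$; if $\Delta\ne0$ and $2L_\Lambda\le r$, replace $x^2B$ by $\Delta^{-1}x^2\Lambda$ and $(L_\Lambda,L_{x^2B})$ by $(L_{x^2B},L_\Lambda+2)$; otherwise replace $x^2B$ by $x^2\cdot x^2B$ and $L_{x^2B}$ by $L_{x^2B}+2$. If at the end $L_\Lambda>t$, declare failure (empty list). 3. If $\Lambda$ has exactly $L_\Lambda$ roots in $\{\alpha^{-i}\}_{i=0}^{n-1}$, the word obtained from $r$ by flipping the bits at the positions of these roots is a candidate. If $L_{x^2B}>t$, return this candidate (or declare failure if there is none) and stop. 4. Put $y_i=-\Lambda(\alpha^{-i})/\big(\alpha^{-2i}B(\alpha^{-i})\big)$, with $y_i=\infty$ if the denominator is $0$. Compute a nonzero $Q(x,y)\in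 F[x,y]$ of $y$-degree at most $P_y$ and of minimum $(2,L_\Lambda-L_{x^2B})$-weighted degree among those passing through all the points $(\alpha^{-2i},y_i)$, $0\le i<n$, with multiplicity $m$; passing through $(a,\infty)$ with multiplicity $m$ means that $y^{P_y}Q(x,1/y)$ passes through $(a,0)$ with multiplicity $m$. 5. (Rational factorization.) With $Q^{(0)}=Q$ and $L_s=t-L_{x^2B}+1+2(t-L_\Lambda)$, find all sequences $s_0,\dots,s_{L_s-1}$ in $F$ such that each $s_i$ is a root of $Q^{(i)}(0,y)$, where $Q^{(i+1)}(x,y)=Q^{(i)}(x,s_i+xy)/x^a$ with the largest possible $a$. 6. For each of them put $s(x)=\sum_i s_ix^i$; let $\lambda(x)$ be the connection polynomial which the Berlekamp–Massey algorithm produces from the $2(t-L_\Lambda)$ terms starting at $s_{t-L_{x^2B}+1}$; let $b=s\lambda \bmod x^{t-L_{x^2B}+1}$ and $\Lambda'=\Lambda(x)\,\lambda(x^2)+x^2B(x)\,b(x^2)$. If the number of roots of $\Lambda'$ in $\{\alpha^{-i}\}_{i=0}^{n-1}$ equals $\deg\Lambda'$, the word obtained from $r$ by flipping the bits at the positions of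 these roots is a candidate. 7. Return all candidates at Hamming distance at most $t$ from $r$. \textbf{Theorem.} For every received word $r$ the algorithm can be carried out (in particular, whenever step 4 is reached, a polynomial $Q$ as required there exists), and, whichever minimizing $Q$ is computed in step 4, the returned list is exactly the set of codewords of $\mathcal C$ within Hamming distance $t$ of $r$. -/

import Mathlib

open scoped Polynomial

namespace BCHListDecoding

open Polynomial

noncomputable section

/-! ### Binary words, the code, syndromes -/

/-- Value at `z` of the polynomial `c₀ + c₁ x + ⋯ + c_{n-1} x^{n-1}` of a binary word. -/
def wordEval {F : Type*} [Field F] [Algebra (ZMod 2) F] {n : ℕ}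
    (c : Fin n → ZMod 2) (z : F) : F :=
  ∑ i : Fin n, algebraMap (ZMod 2) F (c i) * z ^ (i : ℕ)

/-- The narrow-sense binary BCH code of length `n` and designed distance `d`: all binary words
whose polynomial has the roots `α, α², …, α^{d-1}`. -/
def bchCode {F : Type*} [Field F] [Algebra (ZMod 2) F] (n d : ℕ) (α : F) :
    Submodule (ZMod 2) (Fin n → ZMod 2) where
  carrier := {c | ∀ j ∈ Finset.Icc 1 (d - 1), wordEval c (α ^ j) = 0}
  zero_mem' := by
    intro j _
    simp [wordEval]
  add_mem' := by
    intro a b ha hb j hj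
    have h1 := ha j hj
    have h2 := hb j hj
    simp only [wordEval] at h1 h2 ⊢
    simp [add_mul, Finset.sum_add_distrib, h1, h2]
  smul_mem' := by
    intro e a ha j hj
    have h1 := ha j hj
    simp only [wordEval] at h1 ⊢
    simp [mul_assoc, ← Finset.mul_sum, h1]

/-- The syndromes `S_j = R(α^{j+1})` of the received word. -/
def syndrome {F : Type*} [Field F] [Algebra (ZMod 2) F] {n : ℕ}
    (α : F) (r : Fin n → ZMod 2) (j : ℕ) : F :=
  wordEval r (α ^ (j + 1))

/-! ### The Berlekamp algorithm and the Berlekamp-Massey algorithm -/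

/-- The discrepancy `∑_{i=0}^{L} Λ_i S_{r-i}` (there are no syndromes of negative index). -/
def discrepancy {F : Type*} [Field F] (S : ℕ → F) (r : ℕ) (Λ : F[X]) (L : ℕ) : F :=
  ∑ i ∈ Finset.range (L + 1), if i ≤ r then Λ.coeff i * S (r - i) else 0

/-- State of the Berlekamp algorithm. As the initial correction polynomial is `B = x⁻¹`, of
length `-1`, the polynomial `x² B` and its length `L_{x²B} = L_B + 2` are stored. -/
structure BerlekampState (F : Type*) [Field F] where
  /-- the error locator polynomial `Λ` -/
  loc : F[X]
  /-- `x² B`, where `B` is the correction polynomial -/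
  x2B : F[X]
  /-- the length `L_Λ` -/
  lenLoc : ℕ
  /-- the length `L_{x²B} = L_B + 2` -/
  lenX2B : ℕ

open Classical in
/-- One step (`r = 0, 2, 4, …`) of the Berlekamp algorithm. -/
def berlekampStep {F : Type*} [Field F] (S : ℕ → F) (r : ℕ) (s : BerlekampState F) :
    BerlekampState F :=
  let Δ := discrepancy S r s.loc s.lenLoc
  if Δ ≠ 0 ∧ 2 * s.lenLoc ≤ r then
    { loc := s.loc - C Δ * s.x2B
      x2B := X ^ 2 * (C Δ⁻¹ * s.loc)
      lenLoc := s.lenX2B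
      lenX2B := s.lenLoc + 2 }
  else
    { loc := s.loc - C Δ * s.x2B
      x2B := X ^ 2 * s.x2B
      lenLoc := s.lenLoc
      lenX2B := s.lenX2B + 2 }

/-- The state of the Berlekamp algorithm after the steps `r = 0, 2, …, 2(k-1)`. -/
def berlekampIter {F : Type*} [Field F] (S : ℕ → F) : ℕ → BerlekampState F
  | 0 => { loc := 1, x2B := X, lenLoc := 0, lenX2B := 1 }
  | k + 1 => berlekampStep S (2 * k) (berlekampIter S k)

/-- The Berlekamp algorithm for odd designed distance `d`: steps `r = 0, 2, …, d-3` on the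
syndromes `S_0, …, S_{d-2}`. -/
def berlekamp {F : Type*} [Field F] (S : ℕ → F) (d : ℕ) : BerlekampState F :=
  berlekampIter S ((d - 1) / 2)

/-- State of the Berlekamp-Massey algorithm. -/
structure BMState (F : Type*) [Field F] where
  /-- the connection polynomial -/
  loc : F[X]
  /-- the correction polynomial -/
  cor : F[X]
  /-- the length of the connection polynomial -/
  lenLoc : ℕ
  /-- the length of the correction polynomial -/
  lenCor : ℕ

open Classical in
/-- One step of the Berlekamp-Massey algorithm. -/
def bmStep {F : Type*} [Field F] (S : ℕ → F) (r : ℕ) (s : BMState F) : BMState F :=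
  let Δ := discrepancy S r s.loc s.lenLoc
  if Δ ≠ 0 ∧ 2 * s.lenLoc ≤ r then
    { loc := s.loc - C Δ * (X * s.cor)
      cor := C Δ⁻¹ * s.loc
      lenLoc := s.lenCor + 1
      lenCor := s.lenLoc }
  else
    { loc := s.loc - C Δ * (X * s.cor)
      cor := X * s.cor
      lenLoc := s.lenLoc
      lenCor := s.lenCor + 1 }

/-- The Berlekamp-Massey algorithm on the sequence `S_0, …, S_{N-1}`. -/
def berlekampMassey {F : Type*} [Field F] (S : ℕ → F) : ℕ → BMState F
  | 0 => { loc := 1, cor := 1, lenLoc := 0, lenCor := 0 }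
  | N + 1 => bmStep S N (berlekampMassey S N)

/-! ### Rational interpolation

Bivariate polynomials `Q(x, y) = ∑ f_l(x) y^l` are elements of `F[X][X]`: the outer variable is
`y` and `Q.coeff l` is `f_l`. -/

/-- The `(u, w)`-weighted degree: the maximum of `u a + w l` over the monomials `x^a y^l` of `Q`.
The weight `w` may be negative; the zero polynomial has degree `⊥`. -/
def weightedDegree {F : Type*} [Field F] (u w : ℤ) (Q : F[X][X]) : WithBot ℤ :=
  Q.support.sup fun l => ((u * ((Q.coeff l).natDegree : ℤ) + w * (l : ℤ) : ℤ) : WithBot ℤ)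

/-- `Q` passes through the affine point `(a, b)` with multiplicity (at least) `m`:
`Q(x + a, y + b)` has no monomial of total degree less than `m`. -/
def HasMultiplicity {F : Type*} [Field F] (m : ℕ) (Q : F[X][X]) (a b : F) : Prop :=
  ∀ i j : ℕ, i + j < m →
    (((Q.comp (X + C (C b))).coeff j).comp (X + C a)).coeff i = 0

/-- `Q`, of `y`-degree at most `P`, passes with multiplicity `m` through the point `(a, y)`, where
`y = none` stands for the point `(a, ∞)`: there the companion polynomial `y^P Q(x, 1/y)` has to
pass through `(a, 0)` with multiplicity `m`. -/
def PassesThrough {F : Type*} [Field F] (m P : ℕ) (Q : F[X][X]) (a : F) : Option F → Prop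
  | some b => HasMultiplicity m Q a b
  | none => HasMultiplicity m (Q.reflect P) a 0

open Classical in
/-- The ordinate `y_i = -Λ(α^{-i}) / (α^{-2i} B(α^{-i}))`, which is `∞` if the denominator
vanishes. -/
def ordinate {F : Type*} [Field F] (α : F) (s : BerlekampState F) (i : ℕ) : Option F :=
  if s.x2B.eval (α⁻¹ ^ i) = 0 then none
  else some (-(s.loc.eval (α⁻¹ ^ i) / s.x2B.eval (α⁻¹ ^ i)))

/-- `Q` is a nonzero polynomial of `y`-degree at most `P` that passes through all the points
`(α^{-2i}, y_i)`, `0 ≤ i < n`, with multiplicity `m`. -/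
def IsInterpolant {F : Type*} [Field F] (n : ℕ) (α : F) (s : BerlekampState F) (m P : ℕ)
    (Q : F[X][X]) : Prop :=
  Q ≠ 0 ∧ Q.natDegree ≤ P ∧
    ∀ i : Fin n, PassesThrough m P Q (α⁻¹ ^ (2 * (i : ℕ))) (ordinate α s i)

/-- `Q` is a result of the rational interpolation: an interpolant of minimum
`(2, L_Λ - L_{x²B})`-weighted degree. -/
def IsMinInterpolant {F : Type*} [Field F] (n : ℕ) (α : F) (s : BerlekampState F) (m P : ℕ)
    (Q : F[X][X]) : Prop :=
  IsInterpolant n α s m P Q ∧ ∀ Q' : F[X][X], IsInterpolant n α s m P Q' →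
    weightedDegree 2 ((s.lenLoc : ℤ) - s.lenX2B) Q ≤
      weightedDegree 2 ((s.lenLoc : ℤ) - s.lenX2B) Q'

/-! ### Rational factorization -/

/-- The largest `a` such that `x^a` divides `R(x, y)` (and `0` for `R = 0`): the least exponent
of `x` in a monomial of `R`. -/
def xOrder {F : Type*} [Field F] (R : F[X][X]) : ℕ :=
  sInf {k | ∃ l, (R.coeff l).coeff k ≠ 0}

/-- `R(x, y) / x^a` with the largest possible `a`. -/
def removeX {F : Type*} [Field F] (R : F[X][X]) : F[X][X] :=
  ∑ l ∈ R.support, monomial l (divX^[xOrder R] (R.coeff l))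

/-- `Q(x, s + x y)`, freed from all factors `x`. -/
def factorStep {F : Type*} [Field F] (Q : F[X][X]) (s : F) : F[X][X] :=
  removeX (Q.comp (C (C s) + C X * X))

open Classical in
/-- The rational factorization procedure: all sequences `[s_0, …, s_{k-1}]` such that `s_i` is a
root of `Q^{(i)}(0, y)`, where `Q^{(0)} = Q` and `Q^{(i+1)}` is obtained from `Q^{(i)}` and `s_i`. -/
def rationalFactorization {F : Type*} [Field F] [Fintype F] : ℕ → F[X][X] → Finset (List F)
  | 0, _ => {[]}
  | k + 1, Q =>
      (Finset.univ.filter fun s : F => (Q.map (evalRingHom 0)).eval s = 0).biUnion fun s =>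
        (rationalFactorization k (factorStep Q s)).image fun l => s :: l

/-- The polynomial `s_0 + s_1 x + ⋯` of a finite sequence. -/
def seqPoly {F : Type*} [Field F] (l : List F) : F[X] :=
  ∑ i ∈ Finset.range l.length, C (l.getD i 0) * X ^ i

/-! ### The list decoding algorithm -/

/-- The `y`-degree `P_y = ⌊(t m + 1/4) / (t - t₀)⌋`, with `t₀ = d/2`. -/
def yDegree (d t m : ℕ) : ℕ :=
  ⌊((t : ℝ) * m + 1 / 4) / ((t : ℝ) - (d : ℝ) / 2)⌋₊

/-- The multiplicity `⌊t t₀ / (t² - n (t - t₀))⌋`, with `t₀ = d/2`. -/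
def multiplicityBound (n d t : ℕ) : ℕ :=
  ⌊((t : ℝ) * ((d : ℝ) / 2)) / ((t : ℝ) ^ 2 - n * ((t : ℝ) - (d : ℝ) / 2))⌋₊

/-- The constraint (more degrees of freedom than linear conditions) subject to which the
multiplicity may be optimized; `t₀ = d/2`. -/
def FreedomConstraint (n d t m : ℕ) : Prop :=
  (n : ℝ) * m * (m + 1) / 2 <
    -(((t : ℝ) - (d : ℝ) / 2) / 2) *
        ((yDegree d t m : ℝ) -
          (2 * t * m - t + (d : ℝ) / 2 + 1 / 2) / (2 * ((t : ℝ) - (d : ℝ) / 2))) ^ 2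
      + (2 * t * m - t + (d : ℝ) / 2 + 1 / 2) ^ 2 / (8 * ((t : ℝ) - (d : ℝ) / 2))
      + t * m

open Classical in
/-- The positions `i` at which `α^{-i}` is a root of `V`. -/
def rootPositions {F : Type*} [Field F] (n : ℕ) (α : F) (V : F[X]) : Finset (Fin n) :=
  Finset.univ.filter fun i => V.eval (α⁻¹ ^ (i : ℕ)) = 0

open Classical in
/-- The correction of `r` by the error locator polynomial `V` of length `L`: if `V` has exactly
`L` roots among the `α^{-i}`, the bits at these positions are flipped; otherwise there is no
candidate. -/
def candidate {F : Type*} [Field F] {n : ℕ} (α : F) (r : Fin n → ZMod 2) (V : F[X]) (L : ℕ) :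
    Finset (Fin n → ZMod 2) :=
  if (rootPositions n α V).card = L then
    {fun i => if i ∈ rootPositions n α V then r i + 1 else r i}
  else ∅

/-- The polynomial `Λ' = λ(x²) Λ + b(x²) x² B` that is obtained from a power series prefix
`s_0, …, s_{L_s - 1}` of `b / λ`: the Berlekamp-Massey algorithm, started at `s_{t - L_{x²B} + 1}`
and iterated `2 (t - L_Λ)` times, gives `λ`, and `b = s λ mod x^{t - L_{x²B} + 1}`. -/
def candidateLocator {F : Type*} [Field F] (t : ℕ) (s : BerlekampState F) (l : List F) : F[X] :=
  let J := t - s.lenX2B + 1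
  let lam := (berlekampMassey (fun j => l.getD (J + j) 0) (2 * (t - s.lenLoc))).loc
  let b := (seqPoly l * lam) %ₘ (X ^ J)
  lam.comp (X ^ 2) * s.loc + b.comp (X ^ 2) * s.x2B

open Classical in
/-- The list returned after the interpolation polynomial `Q` has been computed. The prefixes have
length `L_s = (t - L_{x²B} + 1) + 2 (t - L_Λ)`. The conventional correction by `Λ` is one of the
candidates. -/
def listFromInterpolant {F : Type*} [Field F] [Fintype F] {n : ℕ} (α : F) (t : ℕ)
    (r : Fin n → ZMod 2) (s : BerlekampState F) (Q : F[X][X]) : Finset (Fin n → ZMod 2) :=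
  (candidate α r s.loc s.lenLoc ∪
    (rationalFactorization ((t - s.lenX2B + 1) + 2 * (t - s.lenLoc)) Q).biUnion fun l =>
      candidate α r (candidateLocator t s l) (candidateLocator t s l).natDegree).filter
    fun c => hammingDist r c ≤ t

/-- `out` is a list returned by the list decoding algorithm with list error correction capability
`t` and multiplicity `m` on the received word `r`. A decoding failure is the empty list. The
algorithm leaves open which of the minimum-degree interpolation polynomials is computed. -/
def IsOutput {F : Type*} [Field F] [Fintype F] [Algebra (ZMod 2) F] {n : ℕ} (α : F) (d t m : ℕ)
    (r : Fin n → ZMod 2) (out : Finset (Fin n → ZMod 2)) : Prop :=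
  let s := berlekamp (syndrome α r) d
  (t < s.lenLoc ∧ out = ∅) ∨
  (s.lenLoc ≤ t ∧ t < s.lenX2B ∧ out = candidate α r s.loc s.lenLoc) ∨
  (s.lenLoc ≤ t ∧ s.lenX2B ≤ t ∧
    ∃ Q : F[X][X], IsMinInterpolant n α s m (yDegree d t m) Q ∧
      out = listFromInterpolant α t r s Q)

end

end BCHListDecoding

namespace BCHListDecoding

open Polynomial
open scoped PowerSeries

section

variable {F : Type*} [Field F]

/-! ### The key equation -/

/-! Write `d = 2k + 1` and `T = 1 + x S` for the syndrome series `S` of `r`. If `S` is replaced by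
the power sums of an error set, Newton's identities turn `V T` into `V - x V'`, where `V` is the
locator of the set, and in characteristic two this has derivative zero. Hence flipping `r` on `E`
gives a codeword exactly when the locator `V` of `E` satisfies `x^{2k} ∣ (V T)'`
(`keyEquation_of_flip_mem`, `flip_mem_of_keyEquation`).

Polynomials in `x²` are constants for the derivative, so the solutions of this key equation form a
module over `F[x²]`, and `(V U)'` serves as the Wronskian of two solutions. The Berlekamp algorithm
keeps two solutions `Λ` and `x²B` with lengths adding up to `d` and `(Λ · x²B)' = x^{2k}`. By
Cramer's rule every solution is `V = λ(x²) Λ + b(x²) x²B`, where `2 deg λ + L_Λ` and `2 deg b +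
L_{x²B}` are at most `deg V` when `λ` and `b` are nonzero
(`BerlekampInvariant.exists_eq_comp_mul_add`). A locator is separable, which makes `λ` and `b`
coprime (`isCoprime_of_separable`); `b = 0` means `V = Λ`, the conventional correction.

If `b ≠ 0`, the roots of `V` say that the curve `y = b/λ` passes through the interpolation points
with index in `E`, so `λ^P Q(x, b/λ)` vanishes to order `m` at `|E|` points. Counting coefficients
gives an interpolant of weighted degree at most `2tm - 1 - P (t - L_Λ)`, and a minimizing `Q`
inherits this bound. As `2m ≤ P`, the degree then falls below `m |E|`, hence `Q(x, b/λ) = 0`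
(`homogEval_eq_zero`). Rational factorization therefore finds the prefix of the series `b/λ`, from
which Berlekamp-Massey restores `λ` and then `b` (`candidateLocator_eq`).

Conversely, each candidate comes from an `F[x²]`-combination of `Λ` and `x²B` with constant
coefficient one and enough roots to be a locator. It is a codeword for any `Q` whatsoever. -/

/-- The series `1 + x S(x)` of a syndrome sequence. -/
noncomputable def keySeries (S : ℕ → F) : F⟦X⟧ := 1 + PowerSeries.X * PowerSeries.mk S

/-- `V` solves the key equation up to `k` steps: the derivative of `V (1 + x S)` vanishes
modulo `x^{2k}`, so that in characteristic two the odd coefficients of `V (1 + x S)` below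
`x^{2k+1}` vanish. -/
def KeyEquation (S : ℕ → F) (k : ℕ) (V : F[X]) : Prop :=
  (PowerSeries.X : F⟦X⟧) ^ (2 * k) ∣ PowerSeries.derivative F ((V : F⟦X⟧) * keySeries S)

theorem constantCoeff_keySeries (S : ℕ → F) : PowerSeries.constantCoeff (keySeries S) = 1 := by
  simp [keySeries]

theorem isUnit_keySeries (S : ℕ → F) : IsUnit (keySeries S) := by
  rw [PowerSeries.isUnit_iff_constantCoeff, constantCoeff_keySeries]
  exact isUnit_one

theorem discrepancy_eq_coeff (S : ℕ → F) (r : ℕ) (V : F[X]) (L : ℕ) (h : V.natDegree ≤ L) :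
    discrepancy S r V L = PowerSeries.coeff r ((V : F⟦X⟧) * PowerSeries.mk S) := by
  rw [PowerSeries.coeff_mul, Finset.Nat.sum_antidiagonal_eq_sum_range_succ_mk]
  simp only [discrepancy, PowerSeries.coeff_mk, Polynomial.coeff_coe]
  set f : ℕ → F := fun i => if i ≤ r then V.coeff i * S (r - i) else 0 with hf
  have h2 : ∑ i ∈ Finset.range (r + 1), V.coeff i * S (r - i) =
      ∑ i ∈ Finset.range (r + 1), f i := by
    apply Finset.sum_congr rfl
    intro i hi
    rw [hf, Finset.mem_range, Nat.lt_succ_iff] at *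
    simp [hi]
  have h3 : ∀ i, (L < i ∨ r < i) → f i = 0 := by
    intro i hi
    simp only [hf]
    split_ifs with h
    · rw [Polynomial.coeff_eq_zero_of_natDegree_lt (by omega), zero_mul]
    · rfl
  rw [h2]
  rw [Finset.sum_subset (Finset.range_mono (le_max_left (L + 1) (r + 1))),
    Finset.sum_subset (Finset.range_mono (le_max_right (L + 1) (r + 1)))]
  · intro i _ hi
    apply h3
    simp at hi
    omega
  · intro i _ hi
    apply h3
    simp at hi
    omega

theorem X_pow_dvd_of_coe {p : F[X]} {k : ℕ} (h : (PowerSeries.X : F⟦X⟧) ^ k ∣ (p : F⟦X⟧)) :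
    X ^ k ∣ p := by
  rw [PowerSeries.X_pow_dvd_iff] at h
  rw [X_pow_dvd_iff]
  intro i hi
  simpa using h i hi

theorem KeyEquation.add {S : ℕ → F} {k : ℕ} {V U : F[X]} (hV : KeyEquation S k V)
    (hU : KeyEquation S k U) : KeyEquation S k (V + U) := by
  unfold KeyEquation
  rw [Polynomial.coe_add, add_mul, map_add]
  exact dvd_add hV hU

theorem KeyEquation.sub {S : ℕ → F} {k : ℕ} {V U : F[X]} (hV : KeyEquation S k V)
    (hU : KeyEquation S k U) : KeyEquation S k (V - U) := by
  unfold KeyEquation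
  rw [Polynomial.coe_sub, sub_mul, map_sub]
  exact dvd_sub hV hU

/-- The length bound for a Cramer quotient. -/
theorem two_mul_natDegree_le {p g : F[X]} {k e : ℕ}
    (h : derivative p = X ^ (2 * k) * g.comp (X ^ 2)) (hp : p.natDegree ≤ e) (hg : g ≠ 0) :
    2 * g.natDegree + 2 * k + 1 ≤ e := by
  have hg2 : g.comp (X ^ 2) ≠ 0 := by
    rw [← expand_eq_comp_X_pow]
    exact (expand_ne_zero (by norm_num)).mpr hg
  have hne : derivative p ≠ 0 := by
    rw [h]
    exact mul_ne_zero (pow_ne_zero _ X_ne_zero) hg2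
  have h1 : p.natDegree ≠ 0 := by
    intro h0
    rw [eq_C_of_natDegree_eq_zero h0, derivative_C] at hne
    exact hne rfl
  -- The strict drop of the degree under differentiation is the `+ 1` of the bound.
  have h2 := natDegree_derivative_lt h1
  rw [h, natDegree_mul (pow_ne_zero _ X_ne_zero) hg2, natDegree_X_pow, natDegree_comp,
    natDegree_X_pow] at h2
  omega

theorem derivative_C_mul_mul (c : F) (V : F[X]) (T : F⟦X⟧) :
    PowerSeries.derivative F (((C c * V : F[X]) : F⟦X⟧) * T) =
      PowerSeries.C c * PowerSeries.derivative F ((V : F⟦X⟧) * T) := by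
  simp [mul_assoc]

theorem KeyEquation.C_mul {S : ℕ → F} {k : ℕ} {V : F[X]} (hV : KeyEquation S k V) (c : F) :
    KeyEquation S k (C c * V) := by
  unfold KeyEquation
  rw [derivative_C_mul_mul]
  exact hV.mul_left _

/-! ### Derivatives and the Wronskian in characteristic two -/

section CharTwo

variable [CharP F 2]

theorem two_mul_cast_eq_zero (k : ℕ) : ((2 * k : ℕ) : F) = 0 := by
  rw [CharP.cast_eq_zero_iff F 2]; exact dvd_mul_right 2 k

theorem coeff_two_mul_succ_derivative (f : F⟦X⟧) (k : ℕ) :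
    PowerSeries.coeff (2 * k + 1) (PowerSeries.derivative F f) = 0 := by
  rw [PowerSeries.coeff_derivative]
  have : ((2 * k + 1 : ℕ) : F) + 1 = ((2 * (k + 1) : ℕ) : F) := by push_cast; ring
  rw [this, two_mul_cast_eq_zero, mul_zero]

theorem coeff_two_mul_derivative (f : F⟦X⟧) (k : ℕ) :
    PowerSeries.coeff (2 * k) (PowerSeries.derivative F f) = PowerSeries.coeff (2 * k + 1) f := by
  rw [PowerSeries.coeff_derivative, two_mul_cast_eq_zero, zero_add, mul_one]

/-- In characteristic two a derivative is a polynomial in `x²`. -/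
theorem exists_derivative_eq_comp (p : F[X]) : ∃ g : F[X], derivative p = g.comp (X ^ 2) := by
  refine ⟨contract 2 (derivative p), ?_⟩
  rw [← expand_eq_comp_X_pow]
  ext i
  rw [coeff_expand (by norm_num)]
  split_ifs with h
  · rw [coeff_contract (by norm_num), Nat.div_mul_cancel h]
  · obtain ⟨k, hk⟩ : ∃ k, i = 2 * k + 1 := ⟨i / 2, by omega⟩
    rw [coeff_derivative, hk]
    have : ((2 * k + 1 : ℕ) : F) + 1 = ((2 * (k + 1) : ℕ) : F) := by push_cast; ring
    rw [this, two_mul_cast_eq_zero, mul_zero]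

theorem derivative_comp_X_sq (g : F[X]) : derivative (g.comp (X ^ 2)) = 0 := by
  rw [derivative_comp, derivative_X_pow]
  simp [CharTwo.two_eq_zero]

theorem derivative_derivative_eq_zero (p : F[X]) : derivative (derivative p) = 0 := by
  obtain ⟨g, hg⟩ := exists_derivative_eq_comp p
  rw [hg, derivative_comp_X_sq]

/-- A derivative divisible by `x^{2k}` has a cofactor that is a polynomial in `x²`. -/
theorem exists_derivative_eq_X_pow_mul_comp (p : F[X]) (k : ℕ) (h : X ^ (2 * k) ∣ derivative p) :
    ∃ g : F[X], derivative p = X ^ (2 * k) * g.comp (X ^ 2) := by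
  obtain ⟨g, hg⟩ := exists_derivative_eq_comp p
  have h1 : X ^ k ∣ g := by
    rw [X_pow_dvd_iff]
    intro i hi
    rw [hg, X_pow_dvd_iff] at h
    have := h (i * 2) (by omega)
    rwa [← expand_eq_comp_X_pow, coeff_expand_mul (by norm_num)] at this
  obtain ⟨g', rfl⟩ := h1
  refine ⟨g', ?_⟩
  rw [hg, mul_comp, X_pow_comp, ← pow_mul]

/-- In characteristic two the Wronskian of `V` and `U` is the derivative of `V U`; multiplication
of both by `1 + x S` scales it by a square. -/
theorem derivative_mul_keySeries_sq (S : ℕ → F) (V U : F[X]) :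
    keySeries S ^ 2 * ((derivative (V * U) : F[X]) : F⟦X⟧) =
      PowerSeries.derivative F ((V : F⟦X⟧) * keySeries S) * ((U : F⟦X⟧) * keySeries S) +
      ((V : F⟦X⟧) * keySeries S) * PowerSeries.derivative F ((U : F⟦X⟧) * keySeries S) := by
  have h2 : (2 : F⟦X⟧) = 0 := by
    have := congrArg (PowerSeries.C (R := F)) CharTwo.two_eq_zero
    rwa [map_ofNat, map_zero] at this
  simp only [← PowerSeries.derivative_coe, Polynomial.coe_mul, Derivation.leibniz, smul_eq_mul]
  linear_combination (- (V : F⟦X⟧) * (U : F⟦X⟧) * keySeries S *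
    PowerSeries.derivative F (keySeries S)) * h2

/-- The square of the unit `1 + x S` cancels from the Wronskian identity. -/
theorem KeyEquation.X_pow_dvd_derivative_mul {S : ℕ → F} {k : ℕ} {V U : F[X]}
    (hV : KeyEquation S k V) (hU : KeyEquation S k U) : X ^ (2 * k) ∣ derivative (V * U) := by
  apply X_pow_dvd_of_coe
  have := derivative_mul_keySeries_sq S V U
  rw [← ((isUnit_keySeries S).pow 2).dvd_mul_left, this]
  exact dvd_add (hV.mul_right _) (hU.mul_left _)

theorem derivative_coe_comp_X_sq_mul (g : F[X]) (f : F⟦X⟧) :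
    PowerSeries.derivative F ((g.comp (X ^ 2) : F[X]) * f) =
      (g.comp (X ^ 2) : F[X]) * PowerSeries.derivative F f := by
  rw [Derivation.leibniz, PowerSeries.derivative_coe, derivative_comp_X_sq]
  simp

/-- Polynomials in `x²` have derivative zero, so solutions form an `F[x²]`-module. -/
theorem KeyEquation.comp_mul {S : ℕ → F} {k : ℕ} {V : F[X]} (hV : KeyEquation S k V) (g : F[X]) :
    KeyEquation S k (g.comp (X ^ 2) * V) := by
  unfold KeyEquation
  rw [Polynomial.coe_mul, mul_assoc, derivative_coe_comp_X_sq_mul]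
  exact hV.mul_left _

/-! ### The Berlekamp algorithm -/

/-- The invariant of the Berlekamp algorithm after `k` steps. -/
structure BerlekampInvariant (S : ℕ → F) (k : ℕ) (s : BerlekampState F) : Prop where
  len_add : s.lenLoc + s.lenX2B = 2 * k + 1
  one_le_lenX2B : 1 ≤ s.lenX2B
  natDegree_loc : s.loc.natDegree ≤ s.lenLoc
  natDegree_x2B : s.x2B.natDegree ≤ s.lenX2B
  loc_zero : s.loc.coeff 0 = 1
  x2B_zero : s.x2B.coeff 0 = 0
  loc_key : KeyEquation S k s.loc
  x2B_key : KeyEquation S k s.x2B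
  x2B_coeff : PowerSeries.coeff (2 * k)
    (PowerSeries.derivative F ((s.x2B : F⟦X⟧) * keySeries S)) = 1

theorem coeff_derivative_mul_keySeries (S : ℕ → F) (k : ℕ) (V : F[X]) (L : ℕ)
    (hV : V.natDegree ≤ L) (hL : L ≤ 2 * k) :
    PowerSeries.coeff (2 * k) (PowerSeries.derivative F ((V : F⟦X⟧) * keySeries S)) =
      discrepancy S (2 * k) V L := by
  rw [coeff_two_mul_derivative, discrepancy_eq_coeff S _ V L hV, keySeries, mul_add, mul_one,
    map_add, Polynomial.coeff_coe, coeff_eq_zero_of_natDegree_lt (by omega), zero_add,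
    mul_left_comm, PowerSeries.coeff_succ_X_mul]

/-- A derivative has no odd coefficients, so a single condition gains two powers of `x`. This is why
the algorithm may skip every other discrepancy. -/
theorem keyEquation_succ {S : ℕ → F} {k : ℕ} {V : F[X]} (hV : KeyEquation S k V)
    (h : PowerSeries.coeff (2 * k) (PowerSeries.derivative F ((V : F⟦X⟧) * keySeries S)) = 0) :
    KeyEquation S (k + 1) V := by
  unfold KeyEquation at *
  rw [PowerSeries.X_pow_dvd_iff] at *
  intro i hi
  obtain h1 | h1 | h1 : i < 2 * k ∨ i = 2 * k ∨ i = 2 * k + 1 := by omega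
  · exact hV i h1
  · rw [h1, h]
  · rw [h1, coeff_two_mul_succ_derivative]

theorem derivative_X_sq_mul_mul (V : F[X]) (T : F⟦X⟧) :
    PowerSeries.derivative F (((X ^ 2 * V : F[X]) : F⟦X⟧) * T) =
      PowerSeries.X ^ 2 * PowerSeries.derivative F ((V : F⟦X⟧) * T) := by
  simpa [mul_assoc] using derivative_coe_comp_X_sq_mul (X : F[X]) ((V : F⟦X⟧) * T)

theorem KeyEquation.X_sq_mul {S : ℕ → F} {k : ℕ} {V : F[X]} (hV : KeyEquation S k V) :
    KeyEquation S (k + 1) (X ^ 2 * V) := by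
  unfold KeyEquation
  rw [derivative_X_sq_mul_mul, mul_add, add_comm, pow_add]
  exact mul_dvd_mul_left _ hV

theorem coeff_derivative_X_sq_mul_mul (V : F[X]) (T : F⟦X⟧) (k : ℕ) :
    PowerSeries.coeff (2 * (k + 1))
      (PowerSeries.derivative F (((X ^ 2 * V : F[X]) : F⟦X⟧) * T)) =
      PowerSeries.coeff (2 * k) (PowerSeries.derivative F ((V : F⟦X⟧) * T)) := by
  rw [derivative_X_sq_mul_mul, mul_add, PowerSeries.coeff_X_pow_mul]

/-- The discrepancy is the leading obstruction of `Λ`, and that of `x²B` is normalized to one;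
subtraction cancels it, while multiplication by `x²` moves an obstruction to the next step. -/
theorem BerlekampInvariant.step {S : ℕ → F} {k : ℕ} {s : BerlekampState F}
    (h : BerlekampInvariant S k s) : BerlekampInvariant S (k + 1) (berlekampStep S (2 * k) s) := by
  have hlen := h.len_add
  have hone := h.one_le_lenX2B
  set Δ := discrepancy S (2 * k) s.loc s.lenLoc with hΔ
  have hcoeff : PowerSeries.coeff (2 * k)
      (PowerSeries.derivative F ((s.loc : F⟦X⟧) * keySeries S)) = Δ :=
    coeff_derivative_mul_keySeries S k s.loc _ h.natDegree_loc (by omega)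
  have hkey : KeyEquation S (k + 1) (s.loc - C Δ * s.x2B) := by
    apply keyEquation_succ (h.loc_key.sub (h.x2B_key.C_mul Δ))
    rw [Polynomial.coe_sub, sub_mul, map_sub, map_sub, derivative_C_mul_mul,
      PowerSeries.coeff_C_mul, hcoeff, h.x2B_coeff, mul_one, sub_self]
  have hzero : (s.loc - C Δ * s.x2B).coeff 0 = 1 := by
    rw [coeff_sub, coeff_C_mul, h.loc_zero, h.x2B_zero, mul_zero, sub_zero]
  have hdeg : (s.loc - C Δ * s.x2B).natDegree ≤ max s.lenLoc s.lenX2B :=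
    (natDegree_sub_le _ _).trans
      (max_le_max h.natDegree_loc ((natDegree_C_mul_le _ _).trans h.natDegree_x2B))
  unfold berlekampStep
  simp only [← hΔ]
  split_ifs with hc
  · obtain ⟨hc1, hc2⟩ := hc
    refine ⟨by simp only; omega, by simp only; omega, hdeg.trans (by simp only; omega), ?_, hzero,
      ?_, hkey, (h.loc_key.C_mul _).X_sq_mul, ?_⟩
    · refine natDegree_mul_le.trans ?_
      rw [natDegree_X_pow, add_comm]
      exact Nat.add_le_add_right ((natDegree_C_mul_le _ _).trans h.natDegree_loc) 2
    · simp
    · simp only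
      rw [coeff_derivative_X_sq_mul_mul, derivative_C_mul_mul, PowerSeries.coeff_C_mul, hcoeff,
        inv_mul_cancel₀ hc1]
  · refine ⟨by simp only; omega, by simp only; omega, ?_, ?_, hzero, ?_, hkey,
      h.x2B_key.X_sq_mul, ?_⟩
    · by_cases hz : Δ = 0
      · simpa [hz] using h.natDegree_loc
      -- The lengths add up to `2k + 1`, so `L_Λ > k` makes `L_Λ` the larger of the two.
      · have : ¬ (2 * s.lenLoc ≤ 2 * k) := fun h' => hc ⟨hz, h'⟩
        exact hdeg.trans (by simp only; omega)
    · refine natDegree_mul_le.trans ?_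
      rw [natDegree_X_pow, add_comm]
      exact Nat.add_le_add_right h.natDegree_x2B 2
    · simp
    · simp only
      rw [coeff_derivative_X_sq_mul_mul, h.x2B_coeff]

theorem berlekampInvariant_iter (S : ℕ → F) (k : ℕ) :
    BerlekampInvariant S k (berlekampIter S k) := by
  induction k with
  | zero =>
    refine ⟨rfl, le_rfl, by simp [berlekampIter], by simp [berlekampIter], by simp [berlekampIter],
      by simp [berlekampIter], by simp [KeyEquation], by simp [KeyEquation], ?_⟩
    rw [coeff_two_mul_derivative]
    simp [berlekampIter, constantCoeff_keySeries, PowerSeries.coeff_succ_X_mul]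
  | succ k ih => exact ih.step

/-! ### Cramer's rule for the solutions of the key equation -/

namespace BerlekampInvariant

variable {S : ℕ → F} {k : ℕ} {s : BerlekampState F}

/-- The lengths bound the degree by `2k`, the key equation gives divisibility by `x^{2k}`, so only
one coefficient remains, and the normalization makes it one. -/
theorem derivative_loc_mul_x2B (h : BerlekampInvariant S k s) :
    derivative (s.loc * s.x2B) = X ^ (2 * k) := by
  have hlen := h.len_add
  have hone := h.one_le_lenX2B
  have hdvd := h.loc_key.X_pow_dvd_derivative_mul h.x2B_key
  have hdeg : (derivative (s.loc * s.x2B)).natDegree ≤ 2 * k := by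
    refine (natDegree_derivative_le _).trans ?_
    have := (natDegree_mul_le (p := s.loc) (q := s.x2B)).trans
      (Nat.add_le_add h.natDegree_loc h.natDegree_x2B)
    omega
  have hcoeff : (derivative (s.loc * s.x2B)).coeff (2 * k) = 1 := by
    obtain ⟨g, hg⟩ := hdvd
    have h1 := derivative_mul_keySeries_sq S s.loc s.x2B
    obtain ⟨a, ha⟩ := h.loc_key
    obtain ⟨b, hb⟩ := h.x2B_key
    have hb0 : PowerSeries.constantCoeff b = 1 := by
      have := h.x2B_coeff
      rw [hb] at this
      simpa [PowerSeries.coeff_X_pow_mul'] using this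
    rw [hg, ha, hb, Polynomial.coe_mul, Polynomial.coe_pow, Polynomial.coe_X] at h1
    have h2 : keySeries S ^ 2 * (g : F⟦X⟧) = a * ((s.x2B : F⟦X⟧) * keySeries S) +
        (s.loc : F⟦X⟧) * keySeries S * b := by
      apply mul_left_cancel₀ (pow_ne_zero (2 * k) (PowerSeries.X_ne_zero (R := F)))
      linear_combination h1
    -- As `x²B` vanishes at `0`, only the term `Λ T (x²B T)'` contributes.
    have h3 := congrArg PowerSeries.constantCoeff h2
    simp only [map_mul, map_add, map_pow, constantCoeff_keySeries, hb0,
      Polynomial.constantCoeff_coe, h.loc_zero, h.x2B_zero] at h3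
    rw [hg, coeff_X_pow_mul']
    simpa using h3
  ext i
  rw [coeff_X_pow]
  split_ifs with hi
  · rw [hi, hcoeff]
  · rcases lt_or_gt_of_ne hi with h1 | h1
    · exact X_pow_dvd_iff.mp hdvd i h1
    · exact coeff_eq_zero_of_natDegree_lt (by omega)

/-- Every solution of the key equation is a combination of the two polynomials of the Berlekamp
algorithm, with bounded degrees. -/
theorem exists_eq_comp_mul_add (h : BerlekampInvariant S k s) {V : F[X]} (hV : KeyEquation S k V) :
    ∃ lam b : F[X], V = lam.comp (X ^ 2) * s.loc + b.comp (X ^ 2) * s.x2B ∧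
      (lam ≠ 0 → 2 * lam.natDegree + s.lenLoc ≤ V.natDegree) ∧
      (b ≠ 0 → 2 * b.natDegree + s.lenX2B ≤ V.natDegree) := by
  obtain ⟨lam, hlam⟩ := exists_derivative_eq_X_pow_mul_comp _ _
    (hV.X_pow_dvd_derivative_mul h.x2B_key)
  obtain ⟨b, hb⟩ := exists_derivative_eq_X_pow_mul_comp _ _
    (h.loc_key.X_pow_dvd_derivative_mul hV)
  have hdet := h.derivative_loc_mul_x2B
  have hlen := h.len_add
  have h2 : (2 : F[X]) = 0 := by
    have := congrArg (C (R := F)) CharTwo.two_eq_zero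
    rwa [map_ofNat, map_zero] at this
  refine ⟨lam, b, ?_, ?_, ?_⟩
  · apply mul_left_cancel₀ (pow_ne_zero (2 * k) (X_ne_zero (R := F)))
    -- Cramer's rule, with determinant `(Λ · x²B)'`.
    have h3 : X ^ (2 * k) * V = derivative (V * s.x2B) * s.loc + derivative (s.loc * V) * s.x2B := by
      rw [← hdet]
      simp only [derivative_mul]
      linear_combination (- s.loc * s.x2B * derivative V) * h2
    rw [h3, hlam, hb]
    ring
  · intro hne
    have := two_mul_natDegree_le hlam
      (natDegree_mul_le.trans (Nat.add_le_add_left h.natDegree_x2B _)) hne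
    omega
  · intro hne
    have := two_mul_natDegree_le hb
      (natDegree_mul_le.trans (Nat.add_le_add_right h.natDegree_loc _)) hne
    omega

/-- The two polynomials have no common root outside of `0`. -/
theorem eval_loc_ne_zero (h : BerlekampInvariant S k s) {z : F} (hz : z ≠ 0)
    (hx : s.x2B.eval z = 0) : s.loc.eval z ≠ 0 := by
  intro h0
  have := congrArg (eval z) h.derivative_loc_mul_x2B
  rw [derivative_mul] at this
  simp only [eval_add, eval_mul, hx, h0, mul_zero, zero_mul, add_zero, eval_pow, eval_X] at this
  exact pow_ne_zero _ hz this.symm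

end BerlekampInvariant

end CharTwo

end

section

variable {F : Type*} [Field F]

/-! ### Error locators -/

/-- The polynomial `∏ (1 - aᵢ x)`. -/
noncomputable def locator {ι : Type*} (a : ι → F) (E : Finset ι) : F[X] :=
  ∏ i ∈ E, (1 - C (a i) * X)

theorem one_sub_C_mul_X_mul_mk (a : F) :
    ((1 - C a * X : F[X]) : F⟦X⟧) * PowerSeries.mk (fun j => a ^ (j + 1)) = PowerSeries.C a := by
  ext n
  have h : ((1 - C a * X : F[X]) : F⟦X⟧) = 1 - PowerSeries.C a * PowerSeries.X := by
    simp
  rw [h, sub_mul, one_mul, map_sub, mul_assoc, PowerSeries.coeff_C_mul, PowerSeries.coeff_C]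
  cases n with
  | zero => simp
  | succ n =>
    rw [PowerSeries.coeff_succ_X_mul]
    simp [pow_succ, mul_comm]

/-- Newton's identities. -/
theorem locator_mul_powerSums {ι : Type*} (a : ι → F) (E : Finset ι) :
    (locator a E : F⟦X⟧) * PowerSeries.mk (fun j => ∑ i ∈ E, a i ^ (j + 1)) =
      -((derivative (locator a E) : F[X]) : F⟦X⟧) := by
  classical
  induction E using Finset.induction_on with
  | empty =>
    have : PowerSeries.mk (fun j => ∑ i ∈ (∅ : Finset ι), a i ^ (j + 1)) = (0 : F⟦X⟧) := by
      ext; simp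
    rw [this]
    simp [locator]
  | insert i E hi ih =>
    have h1 : PowerSeries.mk (fun j => ∑ i ∈ insert i E, a i ^ (j + 1)) =
        PowerSeries.mk (fun j => a i ^ (j + 1)) +
          PowerSeries.mk (fun j => ∑ i ∈ E, a i ^ (j + 1)) := by
      ext n
      simp [Finset.sum_insert hi]
    have h2 : locator a (insert i E) = (1 - C (a i) * X) * locator a E := by
      simp [locator, Finset.prod_insert hi]
    have h3 := one_sub_C_mul_X_mul_mk (a i)
    have h4 : derivative (1 - C (a i) * X) = - C (a i) := by simp
    rw [h1, h2, derivative_mul, h4, Polynomial.coe_mul, Polynomial.coe_add, Polynomial.coe_mul,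
      Polynomial.coe_mul, Polynomial.coe_neg, Polynomial.coe_C]
    linear_combination (locator a E : F⟦X⟧) * h3 + ((1 - C (a i) * X : F[X]) : F⟦X⟧) * ih

theorem locator_coeff_zero {ι : Type*} (a : ι → F) (E : Finset ι) :
    (locator a E).coeff 0 = 1 := by
  rw [coeff_zero_eq_eval_zero, locator, eval_prod]
  simp

theorem natDegree_one_sub_C_mul_X {a : F} (ha : a ≠ 0) : (1 - C a * X).natDegree = 1 := by
  have : (1 - C a * X) = C (-a) * X + C 1 := by simp; ring
  rw [this, natDegree_linear (neg_ne_zero.mpr ha)]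

theorem natDegree_locator {ι : Type*} {a : ι → F} {E : Finset ι} (ha : ∀ i ∈ E, a i ≠ 0) :
    (locator a E).natDegree = E.card := by
  rw [locator, natDegree_prod]
  · rw [Finset.sum_congr rfl (fun i hi => natDegree_one_sub_C_mul_X (ha i hi))]
    simp
  · intro i hi h
    have := natDegree_one_sub_C_mul_X (ha i hi)
    rw [h] at this
    simp at this

theorem separable_locator {ι : Type*} {a : ι → F} {E : Finset ι}
    (hinj : Set.InjOn a E) : (locator a E).Separable := by
  apply separable_prod'
  · intro i hi j hj hij
    have hne : a j - a i ≠ 0 := sub_ne_zero.mpr fun h => hij (hinj hi hj h.symm)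
    refine ⟨C ((a j - a i)⁻¹ * a j), - C ((a j - a i)⁻¹ * a i), ?_⟩
    have : C ((a j - a i)⁻¹) * (C (a j) - C (a i)) = 1 := by
      rw [← C_sub, ← C_mul, inv_mul_cancel₀ hne, C_1]
    simp only [C_mul]
    linear_combination this
  · intro i _
    refine ⟨1, -X, ?_⟩
    have h1 : derivative (1 - C (a i) * X) = - C (a i) := by simp
    rw [h1]
    ring

theorem eval_locator_eq_zero_iff {ι : Type*} {a : ι → F} {E : Finset ι} {z : F} :
    (locator a E).eval z = 0 ↔ ∃ i ∈ E, a i * z = 1 := by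
  rw [locator, eval_prod, Finset.prod_eq_zero_iff]
  refine exists_congr fun i => and_congr_right fun _ => ?_
  rw [eval_sub, eval_one, eval_mul, eval_C, eval_X, sub_eq_zero, eq_comm]

/-- A polynomial with constant coefficient one and at most as many degrees as known nonzero
roots is the locator of these roots. -/
theorem eq_locator {ι : Type*} {a : ι → F} {E : Finset ι} {V : F[X]} (ha : ∀ i ∈ E, a i ≠ 0)
    (hinj : Set.InjOn a E) (h0 : V.coeff 0 = 1) (hdeg : V.natDegree ≤ E.card)
    (hroot : ∀ i ∈ E, V.eval (a i)⁻¹ = 0) : V = locator a E := by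
  classical
  have hinj' : Set.InjOn (fun i => (a i)⁻¹) (E : Set ι) := fun i hi j hj h =>
    hinj hi hj (inv_injective h)
  have hnot : (0 : F) ∉ E.image fun i => (a i)⁻¹ := by
    simp only [Finset.mem_image, not_exists, not_and]
    exact fun i hi => inv_ne_zero (ha i hi)
  -- The point `0`, where both sides are one, supplies the extra interpolation condition.
  apply eq_of_degree_sub_lt_of_eval_finset_eq (insert 0 (E.image fun i => (a i)⁻¹))
  · rw [Finset.card_insert_of_notMem hnot, Finset.card_image_of_injOn hinj']
    refine lt_of_le_of_lt degree_le_natDegree ?_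
    rw [Nat.cast_lt]
    refine Nat.lt_succ_of_le ((natDegree_sub_le _ _).trans ?_)
    rw [natDegree_locator ha]
    simpa using hdeg
  · intro z hz
    rw [Finset.mem_insert, Finset.mem_image] at hz
    rcases hz with rfl | ⟨i, hi, rfl⟩
    · rw [← coeff_zero_eq_eval_zero, ← coeff_zero_eq_eval_zero, h0, locator_coeff_zero]
    · rw [hroot i hi, eq_comm, eval_locator_eq_zero_iff]
      exact ⟨i, hi, mul_inv_cancel₀ (ha i hi)⟩

/-- Later syndromes change `V (1 + x S)` only by a multiple of `x^{2k+1}`, whose derivative is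
divisible by `x^{2k}`. -/
theorem keyEquation_congr {S S' : ℕ → F} {k : ℕ} {V : F[X]} (h : ∀ j < 2 * k, S j = S' j)
    (hV : KeyEquation S k V) : KeyEquation S' k V := by
  unfold KeyEquation at *
  have h1 : PowerSeries.X ^ (2 * k) ∣ (PowerSeries.mk S' - PowerSeries.mk S : F⟦X⟧) := by
    rw [PowerSeries.X_pow_dvd_iff]
    intro j hj
    simp [h j hj]
  obtain ⟨g, hg⟩ := h1
  have h2 : (V : F⟦X⟧) * keySeries S' =
      (V : F⟦X⟧) * keySeries S + PowerSeries.X ^ (2 * k + 1) * ((V : F⟦X⟧) * g) := by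
    simp only [keySeries]
    linear_combination (V : F⟦X⟧) * PowerSeries.X * hg
  rw [h2, map_add]
  refine dvd_add hV ?_
  rw [Derivation.leibniz, Derivation.leibniz_pow]
  refine dvd_add (Dvd.dvd.mul_right (pow_dvd_pow _ (Nat.le_succ _)) _) ?_
  simp only [smul_eq_mul, Nat.add_sub_cancel, nsmul_eq_mul]
  exact ((((dvd_refl _).mul_right _).mul_left _)).mul_left _

section CharTwo

variable [CharP F 2]

/-- By Newton's identities the product is `V - x V'`, with derivative `-x V'' = 0`. -/
theorem keyEquation_locator {ι : Type*} (a : ι → F) (E : Finset ι) (k : ℕ) :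
    KeyEquation (fun j => ∑ i ∈ E, a i ^ (j + 1)) k (locator a E) := by
  unfold KeyEquation
  have h1 : (locator a E : F⟦X⟧) * keySeries (fun j => ∑ i ∈ E, a i ^ (j + 1)) =
      ((locator a E - X * derivative (locator a E) : F[X]) : F⟦X⟧) := by
    rw [keySeries, mul_add, mul_one, mul_left_comm, locator_mul_powerSums]
    simp [sub_eq_add_neg]
  rw [h1, PowerSeries.derivative_coe, derivative_sub, derivative_mul, derivative_X,
    derivative_derivative_eq_zero]
  simp

end CharTwo

/-! ### Words, syndromes and candidates -/

variable [Algebra (ZMod 2) F] {n : ℕ}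

theorem charP_two_of_algebra : CharP F 2 :=
  charP_of_injective_algebraMap (algebraMap (ZMod 2) F).injective 2

theorem mem_bchCode_iff {k : ℕ} {α : F} {c : Fin n → ZMod 2} :
    c ∈ bchCode n (2 * k + 1) α ↔ ∀ j < 2 * k, syndrome α c j = 0 := by
  change (∀ j ∈ Finset.Icc 1 (2 * k + 1 - 1), wordEval c (α ^ j) = 0) ↔ _
  constructor
  · intro h j hj
    exact h (j + 1) (by simp; omega)
  · intro h j hj
    simp at hj
    obtain ⟨i, rfl⟩ : ∃ i, j = i + 1 := ⟨j - 1, by omega⟩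
    exact h i (by omega)

theorem syndrome_add (α : F) (c e : Fin n → ZMod 2) (j : ℕ) :
    syndrome α (c + e) j = syndrome α c j + syndrome α e j := by
  simp [syndrome, wordEval, add_mul, Finset.sum_add_distrib]

theorem syndrome_indicator (α : F) (E : Finset (Fin n)) (j : ℕ) :
    syndrome α (fun i => if i ∈ E then 1 else 0) j = ∑ i ∈ E, (α ^ (i : ℕ)) ^ (j + 1) := by
  simp only [syndrome, wordEval]
  rw [← Finset.sum_subset (Finset.subset_univ E)]
  · refine Finset.sum_congr rfl fun i hi => ?_
    simp [hi, ← pow_mul, mul_comm]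
  · intro i _ hi
    simp [hi]

/-- Frobenius fixes binary coefficients, so the even-indexed syndromes, the only ones that the key
equation controls, determine the others. -/
theorem syndrome_odd (α : F) (c : Fin n → ZMod 2) (j : ℕ) :
    syndrome α c (2 * j + 1) = syndrome α c j ^ 2 := by
  have : CharP F 2 := charP_two_of_algebra
  simp only [syndrome, wordEval]
  rw [sum_pow_char]
  refine Finset.sum_congr rfl fun i _ => ?_
  rw [mul_pow, ← map_pow]
  congr 1
  · rw [show c i ^ 2 = c i from ZMod.pow_card (c i)]
  · rw [← pow_mul, ← pow_mul, ← pow_mul]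
    congr 1
    ring

/-- The word that differs from `r` exactly on `E`. -/
def flip (r : Fin n → ZMod 2) (E : Finset (Fin n)) : Fin n → ZMod 2 :=
  fun i => if i ∈ E then r i + 1 else r i

omit [Algebra (ZMod 2) F] in
theorem mem_candidate_iff {α : F} {r c : Fin n → ZMod 2} {V : F[X]} {L : ℕ} :
    c ∈ candidate α r V L ↔
      (rootPositions n α V).card = L ∧ c = flip r (rootPositions n α V) := by
  unfold candidate
  split_ifs with h
  · rw [Finset.mem_singleton]
    simp only [h, true_and]
    have : (fun i => if i ∈ rootPositions n α V then r i + 1 else r i) =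
        flip r (rootPositions n α V) := by
      funext i
      simp only [flip]
    rw [← this]
  · simp [h]

theorem flip_eq_add (r : Fin n → ZMod 2) (E : Finset (Fin n)) :
    flip r E = r + fun i => if i ∈ E then 1 else 0 := by
  funext i
  simp only [flip, Pi.add_apply]
  split_ifs <;> simp

theorem flip_filter_ne (r c : Fin n → ZMod 2) :
    flip r (Finset.univ.filter fun i => r i ≠ c i) = c := by
  funext i
  simp only [flip, Finset.mem_filter, Finset.mem_univ, true_and]
  generalize r i = x
  generalize c i = y
  revert x y
  decide

theorem hammingDist_flip (r : Fin n → ZMod 2) (E : Finset (Fin n)) :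
    hammingDist r (flip r E) = E.card := by
  unfold hammingDist
  congr 1
  ext i
  rw [Finset.mem_filter, flip]
  split_ifs with h <;> simp [h]

omit [Algebra (ZMod 2) F] in
theorem injective_pow_of_le_orderOf {α : F} (hα : n ≤ orderOf α) :
    Function.Injective fun i : Fin n => α ^ (i : ℕ) := by
  intro i j h
  exact Fin.ext (pow_injOn_Iio_orderOf (by simp; omega) (by simp; omega) h)

omit [Algebra (ZMod 2) F] in
theorem rootPositions_locator {α : F} (hα : n ≤ orderOf α) (hα0 : α ≠ 0) (E : Finset (Fin n)) :
    rootPositions n α (locator (fun i : Fin n => α ^ (i : ℕ)) E) = E := by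
  ext i
  simp only [rootPositions, Finset.mem_filter, Finset.mem_univ, true_and,
    eval_locator_eq_zero_iff]
  constructor
  · rintro ⟨j, hj, h⟩
    rw [inv_pow, mul_inv_eq_one₀ (pow_ne_zero _ hα0)] at h
    rwa [← injective_pow_of_le_orderOf hα h]
  · intro hi
    exact ⟨i, hi, by rw [inv_pow, mul_inv_cancel₀ (pow_ne_zero _ hα0)]⟩

/-- The error locator of a codeword solves the key equation of the received word. -/
theorem keyEquation_of_flip_mem {k : ℕ} {α : F} {r : Fin n → ZMod 2} {E : Finset (Fin n)}
    (h : flip r E ∈ bchCode n (2 * k + 1) α) :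
    KeyEquation (syndrome α r) k (locator (fun i : Fin n => α ^ (i : ℕ)) E) := by
  have : CharP F 2 := charP_two_of_algebra
  rw [mem_bchCode_iff] at h
  refine keyEquation_congr (fun j hj => ?_) (keyEquation_locator _ E k)
  have := h j hj
  rw [flip_eq_add, syndrome_add, syndrome_indicator] at this
  rwa [CharTwo.add_eq_zero, eq_comm] at this

/-- If the error locator of a word solves the key equation, then the corrected word is in the
code. -/
theorem flip_mem_of_keyEquation {k : ℕ} {α : F} {r : Fin n → ZMod 2} {E : Finset (Fin n)}
    (h : KeyEquation (syndrome α r) k (locator (fun i : Fin n => α ^ (i : ℕ)) E)) :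
    flip r E ∈ bchCode n (2 * k + 1) α := by
  have : CharP F 2 := charP_two_of_algebra
  set V := locator (fun i : Fin n => α ^ (i : ℕ)) E with hV
  have h2 := keyEquation_locator (fun i : Fin n => α ^ (i : ℕ)) E k
  have hdvd : PowerSeries.X ^ (2 * k) ∣ PowerSeries.derivative F
      (PowerSeries.X * ((V : F⟦X⟧) * PowerSeries.mk (syndrome α (flip r E)))) := by
    have h3 : PowerSeries.mk (syndrome α (flip r E)) = PowerSeries.mk (syndrome α r) +
        PowerSeries.mk (fun j => ∑ i ∈ E, (α ^ (i : ℕ)) ^ (j + 1)) := by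
      ext j
      rw [map_add, PowerSeries.coeff_mk, PowerSeries.coeff_mk, PowerSeries.coeff_mk, flip_eq_add,
        syndrome_add, syndrome_indicator]
    have h4 : (2 : F⟦X⟧) = 0 := by
      have := congrArg (PowerSeries.C (R := F)) CharTwo.two_eq_zero
      rwa [map_ofNat, map_zero] at this
    -- The two leading ones of the key series cancel in characteristic two.
    have h5 : PowerSeries.X * ((V : F⟦X⟧) * PowerSeries.mk (syndrome α (flip r E))) =
        (V : F⟦X⟧) * keySeries (syndrome α r) +
        (V : F⟦X⟧) * keySeries (fun j => ∑ i ∈ E, (α ^ (i : ℕ)) ^ (j + 1)) := by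
      rw [h3]
      simp only [keySeries]
      linear_combination (- (V : F⟦X⟧)) * h4
    rw [h5, map_add]
    exact dvd_add h h2
  rw [PowerSeries.X_pow_dvd_iff] at hdvd
  rw [mem_bchCode_iff]
  intro j
  induction j using Nat.strong_induction_on with
  | _ j ih =>
    intro hj
    obtain ⟨i, hi | hi⟩ := Nat.even_or_odd' j
    -- For even `j`, all earlier syndromes vanish and `V` has constant coefficient one, so the
    -- coefficient of `x^j` in `V` times the syndrome series is the `j`-th syndrome.
    · have h1 := hdvd j hj
      rw [hi, coeff_two_mul_derivative, PowerSeries.coeff_succ_X_mul, ← hi, PowerSeries.coeff_mul,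
        Finset.sum_eq_single (0, j)] at h1
      · simpa [hV, locator_coeff_zero] using h1
      · rintro ⟨a, b⟩ hab hne
        replace hab : a + b = j := Finset.HasAntidiagonal.mem_antidiagonal.mp hab
        have hb : b < j := by
          rcases Nat.eq_zero_or_pos a with rfl | ha
          · exact absurd (by simpa using hab) hne
          · omega
        simp [ih b hb (hb.trans hj)]
      · intro hne
        simp at hne
    · rw [hi, syndrome_odd, ih i (by omega) (by omega), zero_pow two_ne_zero]

/-- Candidates obtained from solutions of the key equation are codewords. -/
theorem mem_bchCode_of_mem_candidate {k L : ℕ} {α : F} (hα : n ≤ orderOf α) (hα0 : α ≠ 0)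
    {r c : Fin n → ZMod 2} {V : F[X]} (hV : KeyEquation (syndrome α r) k V)
    (h0 : V.coeff 0 = 1) (hL : V.natDegree ≤ L) (hc : c ∈ candidate α r V L) :
    c ∈ bchCode n (2 * k + 1) α := by
  rw [mem_candidate_iff] at hc
  obtain ⟨hcard, rfl⟩ := hc
  apply flip_mem_of_keyEquation
  rwa [← eq_locator (fun i _ => pow_ne_zero _ hα0) (injective_pow_of_le_orderOf hα).injOn h0
    (by omega)]
  intro i hi
  simpa [rootPositions] using hi

omit [Algebra (ZMod 2) F] in
theorem mem_candidate_locator {α : F} (hα : n ≤ orderOf α) (hα0 : α ≠ 0)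
    (r : Fin n → ZMod 2) (E : Finset (Fin n)) :
    flip r E ∈ candidate α r (locator (fun i : Fin n => α ^ (i : ℕ)) E) E.card := by
  rw [mem_candidate_iff, rootPositions_locator hα hα0]
  exact ⟨rfl, rfl⟩

end

section

variable {F : Type*} [Field F]

/-! ### Rational curves through the interpolation points -/

/-- The polynomial `λ^P Q(x, b/λ)`. -/
noncomputable def homogEval (P : ℕ) (Q : F[X][X]) (b lam : F[X]) : F[X] :=
  ∑ l ∈ Finset.range (P + 1), Q.coeff l * b ^ l * lam ^ (P - l)

/-- Stated for any ring containing a value of `b/λ`: rational functions serve for translations in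
`y`, power series for roots of `Q`. -/
theorem map_homogEval {A : Type*} [CommRing A] (φ : F[X] →+* A) {P : ℕ} {Q : F[X][X]}
    (hQ : Q.natDegree ≤ P) {b lam : F[X]} {y : A} (hy : φ b = y * φ lam) :
    φ (homogEval P Q b lam) = φ lam ^ P * eval₂ φ y Q := by
  rw [homogEval, map_sum, eval₂_eq_sum_range' φ (Nat.lt_succ_of_le hQ), Finset.mul_sum]
  refine Finset.sum_congr rfl fun l hl => ?_
  have hl' : l ≤ P := by simpa [Nat.lt_succ_iff] using hl
  rw [map_mul, map_mul, map_pow, map_pow, hy, mul_pow]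
  calc φ (Q.coeff l) * (y ^ l * φ lam ^ l) * φ lam ^ (P - l)
      = φ (Q.coeff l) * y ^ l * (φ lam ^ l * φ lam ^ (P - l)) := by ring
    _ = φ lam ^ P * (φ (Q.coeff l) * y ^ l) := by
      rw [← pow_add, Nat.add_sub_cancel' hl']; ring

theorem homogEval_comp_X_add_C {P : ℕ} {Q : F[X][X]} (hQ : Q.natDegree ≤ P) {b lam : F[X]}
    (hlam : lam ≠ 0) (c : F[X]) :
    homogEval P (Q.comp (X + C c)) (b - c * lam) lam = homogEval P Q b lam := by
  have hinj := RatFunc.algebraMap_injective F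
  have hne : algebraMap F[X] (RatFunc F) lam ≠ 0 := by
    rwa [Ne, map_eq_zero_iff _ hinj]
  apply hinj
  rw [map_homogEval (algebraMap F[X] (RatFunc F)) hQ
    (y := algebraMap F[X] (RatFunc F) b / algebraMap F[X] (RatFunc F) lam)
    (div_mul_cancel₀ _ hne).symm,
    map_homogEval (algebraMap F[X] (RatFunc F)) (y := algebraMap F[X] (RatFunc F) b /
      algebraMap F[X] (RatFunc F) lam - algebraMap F[X] (RatFunc F) c), eval₂_comp]
  · simp
  · rw [natDegree_comp, natDegree_X_add_C, mul_one]
    exact hQ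
  · rw [map_sub, map_mul, sub_mul, div_mul_cancel₀ _ hne]

/-- Exchanging numerator and denominator turns a point at infinity into an affine one. -/
theorem homogEval_reflect {P : ℕ} {Q : F[X][X]} (b lam : F[X]) :
    homogEval P (Q.reflect P) lam b = homogEval P Q b lam := by
  unfold homogEval
  rw [← Finset.sum_range_reflect]
  refine Finset.sum_congr rfl fun l hl => ?_
  have hl' : l ≤ P := by simpa [Nat.lt_succ_iff] using hl
  have h1 : P + 1 - 1 - l = P - l := by omega
  rw [h1, coeff_reflect, revAt_le (Nat.sub_le _ _), Nat.sub_sub_self hl']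
  ring

theorem pow_dvd_homogEval {P m : ℕ} {Q : F[X][X]} {b lam p : F[X]} (hb : p ∣ b)
    (hQ : ∀ j, p ^ (m - j) ∣ Q.coeff j) : p ^ m ∣ homogEval P Q b lam := by
  refine Finset.dvd_sum fun l _ => Dvd.dvd.mul_right ?_ _
  refine (pow_dvd_pow p (show m ≤ (m - l) + l by omega)).trans ?_
  rw [pow_add]
  exact mul_dvd_mul (hQ l) (pow_dvd_pow_of_dvd hb l)

theorem X_sub_C_pow_dvd_of_comp {p : F[X]} {a : F} {k : ℕ} (h : X ^ k ∣ p.comp (X + C a)) :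
    (X - C a) ^ k ∣ p := by
  obtain ⟨g, hg⟩ := h
  refine ⟨g.comp (X - C a), ?_⟩
  have := congrArg (fun q : F[X] => q.comp (X - C a)) hg
  simpa [comp_assoc] using this

theorem HasMultiplicity.X_sub_C_pow_dvd_coeff {m : ℕ} {Q : F[X][X]} {a c : F}
    (h : HasMultiplicity m Q a c) (j : ℕ) :
    (X - C a) ^ (m - j) ∣ (Q.comp (X + C (C c))).coeff j := by
  apply X_sub_C_pow_dvd_of_comp
  rw [X_pow_dvd_iff]
  intro i hi
  exact h i j (by omega)

/-- After translation by `c` the numerator `b - cλ` vanishes at `a`; each missing factor in the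
coefficient of `y^l` is supplied by its `l`-th power. -/
theorem HasMultiplicity.X_sub_C_pow_dvd_homogEval {m P : ℕ} {Q : F[X][X]} {a c : F}
    (h : HasMultiplicity m Q a c) (hQ : Q.natDegree ≤ P) {b lam : F[X]} (hlam : lam ≠ 0)
    (hb : b.eval a = c * lam.eval a) : (X - C a) ^ m ∣ homogEval P Q b lam := by
  rw [← homogEval_comp_X_add_C hQ hlam (C c)]
  apply pow_dvd_homogEval _ h.X_sub_C_pow_dvd_coeff
  rw [dvd_iff_isRoot, IsRoot.def]
  simp [hb]

theorem PassesThrough.X_sub_C_pow_dvd_homogEval {m P : ℕ} {Q : F[X][X]} {a : F} {y : Option F}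
    (h : PassesThrough m P Q a y) (hQ : Q.natDegree ≤ P) {b lam : F[X]} (hlam : lam ≠ 0)
    (hb : b ≠ 0) (hsome : ∀ c, y = some c → b.eval a = c * lam.eval a)
    (hnone : y = none → lam.eval a = 0) : (X - C a) ^ m ∣ homogEval P Q b lam := by
  cases y with
  | some c => exact HasMultiplicity.X_sub_C_pow_dvd_homogEval h hQ hlam (hsome c rfl)
  | none =>
    rw [← homogEval_reflect]
    refine HasMultiplicity.X_sub_C_pow_dvd_homogEval h ?_ hb (by simp [hnone rfl])
    exact natDegree_reflect_le.trans (max_le le_rfl hQ)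

theorem weightedDegree_le_iff {u w D : ℤ} {Q : F[X][X]} :
    weightedDegree u w Q ≤ (D : WithBot ℤ) ↔
      ∀ l, Q.coeff l ≠ 0 → u * ((Q.coeff l).natDegree : ℤ) + w * l ≤ D := by
  simp only [weightedDegree, Finset.sup_le_iff, WithBot.coe_le_coe, mem_support_iff]

/-- With weight `L₁ - L₂` for `y`, the bounds on the summands no longer depend on `l`: it
compensates the different degree bounds for `b` and `λ`. -/
theorem two_mul_natDegree_homogEval_le {P : ℕ} {Q : F[X][X]} {b lam : F[X]} {D L₁ L₂ e : ℤ}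
    (hQ : ∀ l, Q.coeff l ≠ 0 → 2 * ((Q.coeff l).natDegree : ℤ) + (L₁ - L₂) * l ≤ D)
    (hlam : 2 * (lam.natDegree : ℤ) + L₁ ≤ e) (hb : 2 * (b.natDegree : ℤ) + L₂ ≤ e)
    (hne : homogEval P Q b lam ≠ 0) :
    2 * ((homogEval P Q b lam).natDegree : ℤ) ≤ D + P * (e - L₁) := by
  have h1 : (homogEval P Q b lam).coeff (homogEval P Q b lam).natDegree ≠ 0 := by
    rwa [coeff_natDegree, Ne, leadingCoeff_eq_zero]
  conv at h1 => enter [1, 1]; rw [homogEval]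
  rw [finsetSum_coeff] at h1
  obtain ⟨l, hl, h2⟩ := Finset.exists_ne_zero_of_sum_ne_zero h1
  have hl' : l ≤ P := by simpa [Nat.lt_succ_iff] using hl
  have h3 := le_natDegree_of_ne_zero h2
  have h4 : Q.coeff l ≠ 0 := by
    intro h
    simp [h] at h2
  have h5 := hQ l h4
  have h6 : (Q.coeff l * b ^ l * lam ^ (P - l)).natDegree ≤
      (Q.coeff l).natDegree + l * b.natDegree + (P - l) * lam.natDegree :=
    natDegree_mul_le.trans (Nat.add_le_add
      (natDegree_mul_le.trans (Nat.add_le_add_left natDegree_pow_le _)) natDegree_pow_le)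
  have h7 := h3.trans h6
  zify [hl'] at h7
  have h8 : (l : ℤ) * (2 * (b.natDegree : ℤ) + L₂) ≤ l * e :=
    mul_le_mul_of_nonneg_left hb (by positivity)
  have h9 : ((P : ℤ) - l) * (2 * (lam.natDegree : ℤ) + L₁) ≤ (P - l) * e :=
    mul_le_mul_of_nonneg_left hlam (by linarith [(Nat.cast_le (α := ℤ)).mpr hl'])
  nlinarith

theorem eq_zero_of_X_sub_C_pow_dvd {ι : Type*} {x : ι → F} {E : Finset ι} (hx : Set.InjOn x E)
    {m : ℕ} {p : F[X]} (hdvd : ∀ i ∈ E, (X - C (x i)) ^ m ∣ p)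
    (hdeg : p ≠ 0 → p.natDegree < m * E.card) : p = 0 := by
  by_contra hne
  have h1 : ∏ i ∈ E, (X - C (x i)) ^ m ∣ p := by
    apply Finset.prod_dvd_of_coprime _ hdvd
    intro i hi j hj hij
    apply IsCoprime.pow
    apply isCoprime_X_sub_C_of_isUnit_sub
    rw [isUnit_iff_ne_zero, sub_ne_zero]
    exact fun h => hij (hx hi hj h)
  have h2 := natDegree_le_of_dvd h1 hne
  rw [natDegree_prod _ _ fun i _ => pow_ne_zero _ (X_sub_C_ne_zero _)] at h2
  simp only [natDegree_pow, natDegree_X_sub_C, mul_one, Finset.sum_const, smul_eq_mul] at h2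
  have := hdeg hne
  rw [mul_comm] at this
  omega

/-! ### Rational factorization -/

theorem coeff_divX_iterate (a : ℕ) (p : F[X]) (k : ℕ) :
    (divX^[a] p).coeff k = p.coeff (k + a) := by
  induction a generalizing k with
  | zero => rfl
  | succ a ih => rw [Function.iterate_succ_apply', coeff_divX, ih, add_right_comm, add_assoc]

theorem coeff_removeX (R : F[X][X]) (l : ℕ) :
    (removeX R).coeff l = divX^[xOrder R] (R.coeff l) := by
  rw [removeX, finsetSum_coeff]
  simp only [coeff_monomial, Finset.sum_ite_eq', mem_support_iff]
  split_ifs with h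
  · rfl
  · rw [mem_support_iff, not_not] at h
    ext k
    rw [coeff_divX_iterate, h]
    simp

theorem C_X_pow_mul_removeX (R : F[X][X]) : C (X ^ xOrder R) * removeX R = R := by
  ext l k
  rw [coeff_C_mul, coeff_removeX, coeff_X_pow_mul']
  split_ifs with h
  · rw [coeff_divX_iterate, Nat.sub_add_cancel h]
  · by_contra hne
    exact h (Nat.sInf_le ⟨l, fun h0 => hne h0.symm⟩)

/-- Rational factorization finds all prefixes of power series roots. -/
theorem mem_rationalFactorization [Fintype F] (k : ℕ) {Q : F[X][X]} {s : F⟦X⟧}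
    (h : eval₂ coeToPowerSeries.ringHom s Q = 0) :
    (List.range k).map (fun i => PowerSeries.coeff i s) ∈ rationalFactorization k Q := by
  classical
  induction k generalizing Q s with
  | zero => simp [rationalFactorization]
  | succ k ih =>
    rw [rationalFactorization, Finset.mem_biUnion]
    refine ⟨PowerSeries.coeff 0 s, ?_, ?_⟩
    · rw [Finset.mem_filter, eval_map]
      refine ⟨Finset.mem_univ _, ?_⟩
      have h1 := congrArg PowerSeries.constantCoeff h
      rw [hom_eval₂, map_zero] at h1
      have h2 : evalRingHom (0 : F) =
          PowerSeries.constantCoeff.comp coeToPowerSeries.ringHom := by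
        ext <;> simp
      rw [h2, PowerSeries.coeff_zero_eq_constantCoeff_apply]
      exact h1
    · rw [Finset.mem_image]
      set s' : F⟦X⟧ := PowerSeries.mk fun i => PowerSeries.coeff (i + 1) s with hs'
      refine ⟨(List.range k).map (fun i => PowerSeries.coeff i s'), ih ?_, ?_⟩
      · have hs : s = PowerSeries.C (PowerSeries.constantCoeff s) + PowerSeries.X * s' := by
          rw [add_comm]
          exact PowerSeries.eq_X_mul_shift_add_const s
        -- Substituting `s = s₀ + x s'` makes the tail `s'` a root of the transformed polynomial;
        -- the removed power of `x` is not a zero divisor.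
        have h2 : eval₂ coeToPowerSeries.ringHom s'
            (Q.comp (C (C (PowerSeries.coeff 0 s)) + C X * X)) = 0 := by
          rw [eval₂_comp, ← h]
          congr 1
          rw [eval₂_add, eval₂_mul, eval₂_C, eval₂_C, eval₂_X]
          conv_rhs => rw [hs]
          simp
        rw [← C_X_pow_mul_removeX (Q.comp _), eval₂_mul, eval₂_C, mul_eq_zero] at h2
        refine h2.resolve_left ?_
        simp [PowerSeries.X_ne_zero]
      · rw [List.range_succ_eq_map, List.map_cons, List.map_map]
        congr 1
        refine List.map_congr_left fun i _ => ?_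
        simp [hs']

end

section

variable {F : Type*} [Field F]

/-! ### The Berlekamp-Massey algorithm -/

/-- The invariant of the Berlekamp-Massey algorithm after `N` steps; `rho` and `sigma` are the
numerators that belong to the connection polynomial and to `x` times the correction polynomial. -/
structure BMInvariant (S : ℕ → F) (N : ℕ) (s : BMState F) (rho sigma : F[X]) : Prop where
  len_add : s.lenLoc + s.lenCor = N
  natDegree_loc : s.loc.natDegree ≤ s.lenLoc
  natDegree_cor : s.cor.natDegree ≤ s.lenCor
  degree_rho : rho.degree < s.lenLoc
  degree_sigma : sigma.degree < ((s.lenCor + 1 : ℕ) : WithBot ℕ)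
  loc_zero : s.loc.coeff 0 = 1
  loc_key : (PowerSeries.X : F⟦X⟧) ^ N ∣ (s.loc : F⟦X⟧) * PowerSeries.mk S - (rho : F⟦X⟧)
  cor_key : (PowerSeries.X : F⟦X⟧) ^ N ∣
    ((X * s.cor : F[X]) : F⟦X⟧) * PowerSeries.mk S - (sigma : F⟦X⟧)
  cor_coeff : PowerSeries.coeff N
    (((X * s.cor : F[X]) : F⟦X⟧) * PowerSeries.mk S - (sigma : F⟦X⟧)) = 1

theorem X_pow_succ_dvd {f : F⟦X⟧} {N : ℕ} (h : PowerSeries.X ^ N ∣ f)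
    (h0 : PowerSeries.coeff N f = 0) : PowerSeries.X ^ (N + 1) ∣ f := by
  rw [PowerSeries.X_pow_dvd_iff] at *
  intro i hi
  rcases Nat.lt_succ_iff_lt_or_eq.mp hi with h1 | rfl
  · exact h i h1
  · exact h0

theorem degree_X_mul_lt {p : F[X]} {L : ℕ} (h : p.degree < L) : (X * p).degree < ((L + 1 : ℕ) : WithBot ℕ) := by
  rw [degree_lt_iff_coeff_zero] at *
  intro i hi
  obtain ⟨j, rfl⟩ : ∃ j, i = j + 1 := ⟨i - 1, by omega⟩
  rw [coeff_X_mul, h j (by omega)]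

theorem degree_C_mul_lt {p : F[X]} {L : WithBot ℕ} (h : p.degree < L) (c : F) :
    (C c * p).degree < L := by
  rw [← smul_eq_C_mul]
  exact (degree_smul_le c p).trans_lt h

theorem BMInvariant.step {S : ℕ → F} {N : ℕ} {s : BMState F} {rho sigma : F[X]}
    (h : BMInvariant S N s rho sigma) :
    ∃ rho' sigma', BMInvariant S (N + 1) (bmStep S N s) rho' sigma' := by
  have hlen := h.len_add
  set Δ := discrepancy S N s.loc s.lenLoc with hΔ
  set f : F⟦X⟧ := (s.loc : F⟦X⟧) * PowerSeries.mk S - (rho : F⟦X⟧) with hf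
  set g : F⟦X⟧ := ((X * s.cor : F[X]) : F⟦X⟧) * PowerSeries.mk S - (sigma : F⟦X⟧) with hg
  have hcoeff : PowerSeries.coeff N f = Δ := by
    rw [hf, map_sub, hΔ, discrepancy_eq_coeff S _ _ _ h.natDegree_loc, Polynomial.coeff_coe,
      degree_lt_iff_coeff_zero _ _ |>.mp h.degree_rho N (by omega), sub_zero]
  have hkey : ((s.loc - C Δ * (X * s.cor) : F[X]) : F⟦X⟧) * PowerSeries.mk S -
      ((rho - C Δ * sigma : F[X]) : F⟦X⟧) = f - PowerSeries.C Δ * g := by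
    rw [hf, hg, Polynomial.coe_sub, Polynomial.coe_sub, Polynomial.coe_mul (C Δ),
      Polynomial.coe_mul (C Δ), Polynomial.coe_C]
    ring
  have hdvd : PowerSeries.X ^ (N + 1) ∣
      ((s.loc - C Δ * (X * s.cor) : F[X]) : F⟦X⟧) * PowerSeries.mk S -
      ((rho - C Δ * sigma : F[X]) : F⟦X⟧) := by
    rw [hkey]
    apply X_pow_succ_dvd (dvd_sub h.loc_key (h.cor_key.mul_left _))
    rw [map_sub, PowerSeries.coeff_C_mul, hcoeff, h.cor_coeff, mul_one, sub_self]
  have hzero : (s.loc - C Δ * (X * s.cor)).coeff 0 = 1 := by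
    rw [coeff_sub, coeff_C_mul, h.loc_zero]
    simp
  have hXcor : (X * s.cor).natDegree ≤ s.lenCor + 1 :=
    natDegree_mul_le.trans (by rw [natDegree_X, add_comm]; exact Nat.succ_le_succ h.natDegree_cor)
  have hdeg : (s.loc - C Δ * (X * s.cor)).natDegree ≤ max s.lenLoc (s.lenCor + 1) :=
    (natDegree_sub_le _ _).trans
      (max_le_max h.natDegree_loc ((natDegree_C_mul_le _ _).trans hXcor))
  have hdeg' : (rho - C Δ * sigma).degree < ((max s.lenLoc (s.lenCor + 1) : ℕ) : WithBot ℕ) := by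
    refine (degree_sub_le _ _).trans_lt (max_lt (h.degree_rho.trans_le ?_)
      ((degree_C_mul_lt h.degree_sigma _).trans_le ?_))
    · exact_mod_cast le_max_left _ _
    · exact_mod_cast le_max_right _ _
  unfold bmStep
  simp only [← hΔ]
  split_ifs with hc
  · obtain ⟨hc1, hc2⟩ := hc
    have hmax : max s.lenLoc (s.lenCor + 1) = s.lenCor + 1 := by omega
    rw [hmax] at hdeg hdeg'
    have h1 : ((X * (C Δ⁻¹ * s.loc) : F[X]) : F⟦X⟧) * PowerSeries.mk S -
        ((X * (C Δ⁻¹ * rho) : F[X]) : F⟦X⟧) = PowerSeries.X * (PowerSeries.C Δ⁻¹ * f) := by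
      rw [hf]
      simp only [Polynomial.coe_mul, Polynomial.coe_C, Polynomial.coe_X]
      ring
    refine ⟨rho - C Δ * sigma, X * (C Δ⁻¹ * rho), by simp only; omega, hdeg,
      (natDegree_C_mul_le _ _).trans h.natDegree_loc, hdeg',
      degree_X_mul_lt (degree_C_mul_lt h.degree_rho _), hzero, hdvd, ?_, ?_⟩
    · simp only
      rw [h1, pow_succ']
      exact mul_dvd_mul_left _ (h.loc_key.mul_left _)
    · simp only
      rw [h1, PowerSeries.coeff_succ_X_mul, PowerSeries.coeff_C_mul, hcoeff, inv_mul_cancel₀ hc1]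
  · have h1 : ((X * (X * s.cor) : F[X]) : F⟦X⟧) * PowerSeries.mk S -
        ((X * sigma : F[X]) : F⟦X⟧) = PowerSeries.X * g := by
      rw [hg, Polynomial.coe_mul X (X * s.cor), Polynomial.coe_mul X sigma, Polynomial.coe_X]
      ring
    have h2 : Δ = 0 ∨ max s.lenLoc (s.lenCor + 1) = s.lenLoc := by
      by_cases hz : Δ = 0
      · exact Or.inl hz
      · have : ¬ (2 * s.lenLoc ≤ N) := fun h' => hc ⟨hz, h'⟩
        right
        omega
    refine ⟨rho - C Δ * sigma, X * sigma, by simp only; omega, ?_, hXcor, ?_,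
      degree_X_mul_lt h.degree_sigma, hzero, hdvd, ?_, ?_⟩
    · rcases h2 with h2 | h2
      · simpa [h2] using h.natDegree_loc
      · simpa only [h2] using hdeg
    · rcases h2 with h2 | h2
      · simpa [h2] using h.degree_rho
      · simpa only [h2] using hdeg'
    · simp only
      rw [h1, pow_succ']
      exact mul_dvd_mul_left _ h.cor_key
    · simp only
      rw [h1, PowerSeries.coeff_succ_X_mul, h.cor_coeff]

theorem exists_bmInvariant (S : ℕ → F) (N : ℕ) :
    ∃ rho sigma, BMInvariant S N (berlekampMassey S N) rho sigma := by
  induction N with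
  | zero =>
    -- The numerator `-1` makes the initial residual of `x · cor` equal to `x S + 1`, with the
    -- required coefficient one.
    refine ⟨0, -1, rfl, by simp [berlekampMassey], by simp [berlekampMassey], ?_, ?_,
      by simp [berlekampMassey], by simp, by simp, by simp [berlekampMassey]⟩
    · simp [berlekampMassey]
    · simp [berlekampMassey]
  | succ N ih =>
    obtain ⟨rho, sigma, h⟩ := ih
    exact h.step

theorem coeff_zero_berlekampMassey (S : ℕ → F) (N : ℕ) :
    (berlekampMassey S N).loc.coeff 0 = 1 := by
  obtain ⟨_, _, h⟩ := exists_bmInvariant S N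
  exact h.loc_zero

/-- A polynomial of degree less than `N` that is divisible by `x^N` vanishes. -/
theorem eq_zero_of_X_pow_dvd_coe {p : F[X]} {N : ℕ} (hdeg : p.degree < N)
    (h : (PowerSeries.X : F⟦X⟧) ^ N ∣ (p : F⟦X⟧)) : p = 0 := by
  ext i
  rw [PowerSeries.X_pow_dvd_iff] at h
  rcases lt_or_ge i N with hi | hi
  · simpa using h i hi
  · simpa using (degree_lt_iff_coeff_zero _ _).mp hdeg i hi

theorem degree_mul_lt {p q : F[X]} {a b : ℕ} (hp : p.natDegree ≤ a) (hq : q.degree < b) :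
    (p * q).degree < ((a + b : ℕ) : WithBot ℕ) := by
  by_cases hq0 : q = 0
  · simp only [hq0, mul_zero, degree_zero]
    exact WithBot.bot_lt_coe _
  by_cases hp0 : p = 0
  · simp only [hp0, zero_mul, degree_zero]
    exact WithBot.bot_lt_coe _
  rw [degree_mul, degree_eq_natDegree hp0, degree_eq_natDegree hq0] at *
  norm_cast at *
  omega

theorem X_pow_dvd_cross {u : F⟦X⟧} {N : ℕ} {p q r s : F[X]}
    (h1 : PowerSeries.X ^ N ∣ (p : F⟦X⟧) * u - (r : F⟦X⟧))
    (h2 : PowerSeries.X ^ N ∣ (q : F⟦X⟧) * u - (s : F⟦X⟧)) :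
    PowerSeries.X ^ N ∣ ((p * s - q * r : F[X]) : F⟦X⟧) := by
  have : ((p * s - q * r : F[X]) : F⟦X⟧) =
      (q : F⟦X⟧) * ((p : F⟦X⟧) * u - r) - (p : F⟦X⟧) * ((q : F⟦X⟧) * u - s) := by
    simp only [Polynomial.coe_sub, Polynomial.coe_mul]
    ring
  rw [this]
  exact dvd_sub (h1.mul_left _) (h2.mul_left _)

/-- The length of the connection polynomial is minimal. -/
theorem BMInvariant.lenLoc_le {S : ℕ → F} {N : ℕ} {s : BMState F} {rho sigma : F[X]}
    (h : BMInvariant S N s rho sigma) {lam tau : F[X]} {p : ℕ} (hlam : lam.natDegree ≤ p)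
    (htau : tau.degree < p) (h0 : lam.coeff 0 = 1)
    (hkey : PowerSeries.X ^ N ∣ (lam : F⟦X⟧) * PowerSeries.mk S - (tau : F⟦X⟧)) :
    s.lenLoc ≤ p := by
  by_contra hlt
  have hlen := h.len_add
  have hXcor : (X * s.cor).natDegree ≤ s.lenCor + 1 :=
    natDegree_mul_le.trans (by rw [natDegree_X, add_comm]; exact Nat.succ_le_succ h.natDegree_cor)
  -- If `p < L`, all degrees here are below `N`, so the congruence is an equality. It pushes the
  -- residual of `x · cor` to order `N + 1`, against its normalization.
  have h1 : lam * sigma - X * s.cor * tau = 0 := by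
    refine eq_zero_of_X_pow_dvd_coe (N := N) ?_ (X_pow_dvd_cross hkey h.cor_key)
    refine (degree_sub_le _ _).trans_lt (max_lt ((degree_mul_lt hlam h.degree_sigma).trans_le ?_)
      ((degree_mul_lt hXcor htau).trans_le ?_))
    · exact_mod_cast (by omega)
    · exact_mod_cast (by omega)
  have h2 : (PowerSeries.X : F⟦X⟧) ^ (N + 1) ∣
      (lam : F⟦X⟧) * (((X * s.cor : F[X]) : F⟦X⟧) * PowerSeries.mk S - (sigma : F⟦X⟧)) := by
    have h3 := congrArg (fun q : F[X] => (q : F⟦X⟧)) h1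
    simp only [Polynomial.coe_sub, Polynomial.coe_mul, Polynomial.coe_zero,
      Polynomial.coe_X] at h3
    have h4 : (lam : F⟦X⟧) * (((X * s.cor : F[X]) : F⟦X⟧) * PowerSeries.mk S - (sigma : F⟦X⟧)) =
        PowerSeries.X * ((s.cor : F⟦X⟧) * ((lam : F⟦X⟧) * PowerSeries.mk S - (tau : F⟦X⟧))) := by
      simp only [Polynomial.coe_mul, Polynomial.coe_X]
      linear_combination -h3
    rw [h4, pow_succ']
    exact mul_dvd_mul_left _ (hkey.mul_left _)
  obtain ⟨g, hg⟩ := h.cor_key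
  have hc := h.cor_coeff
  rw [hg] at h2 hc
  rw [PowerSeries.X_pow_dvd_iff] at h2
  have h5 := h2 N (Nat.lt_succ_self N)
  rw [mul_left_comm, PowerSeries.coeff_X_pow_mul'] at h5
  rw [PowerSeries.coeff_X_pow_mul'] at hc
  simp [h0] at h5 hc
  simp [hc] at h5

/-- The Berlekamp-Massey algorithm recovers the denominator of a reduced fraction from a
sufficiently long prefix of its power series. -/
theorem berlekampMassey_loc_eq {S : ℕ → F} {N : ℕ} {lam tau : F[X]}
    (htau : tau.degree < lam.natDegree) (h0 : lam.coeff 0 = 1)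
    (hN : 2 * lam.natDegree ≤ N) (hcop : IsCoprime lam tau)
    (hkey : PowerSeries.X ^ N ∣ (lam : F⟦X⟧) * PowerSeries.mk S - (tau : F⟦X⟧)) :
    (berlekampMassey S N).loc = lam := by
  obtain ⟨rho, sigma, h⟩ := exists_bmInvariant S N
  have hle := h.lenLoc_le le_rfl htau h0 hkey
  set V := (berlekampMassey S N).loc with hV
  -- Degrees stay below `2 deg λ ≤ N`, so the two fractions agree exactly, not only modulo `x^N`.
  have h1 : V * tau - lam * rho = 0 := by
    refine eq_zero_of_X_pow_dvd_coe (N := N) ?_ (X_pow_dvd_cross h.loc_key hkey)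
    refine (degree_sub_le _ _).trans_lt (max_lt
      ((degree_mul_lt h.natDegree_loc htau).trans_le ?_)
      ((degree_mul_lt le_rfl h.degree_rho).trans_le ?_))
    · exact_mod_cast (by omega)
    · exact_mod_cast (by omega)
  have h2 : lam ∣ V := by
    apply hcop.dvd_of_dvd_mul_right
    exact ⟨rho, by linear_combination h1⟩
  obtain ⟨c, hc⟩ := h2
  have hV0 : V ≠ 0 := fun hz => by simpa [← hV, hz] using h.loc_zero
  have hc0 : c ≠ 0 := fun hz => hV0 (by rw [hc, hz, mul_zero])
  have hlam0 : lam ≠ 0 := fun hz => hV0 (by rw [hc, hz, zero_mul])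
  have hdeg : c.natDegree = 0 := by
    have := h.natDegree_loc
    rw [← hV, hc, natDegree_mul hlam0 hc0] at this
    omega
  have hcoeff := h.loc_zero
  rw [← hV, hc, mul_coeff_zero, h0, one_mul] at hcoeff
  rw [hc, eq_C_of_natDegree_eq_zero hdeg, hcoeff, C_1, mul_one]

end

section

variable {F : Type*} [Field F]

/-! ### Existence of interpolants -/

/-- The coefficient of `x^i y^j` in `Q(x + a, y + c)`, as a linear functional. -/
noncomputable def shiftedCoeff (a c : F) (i j : ℕ) : F[X][X] →ₗ[F] F where
  toFun Q := (((Q.comp (X + C (C c))).coeff j).comp (X + C a)).coeff i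
  map_add' Q R := by simp
  map_smul' e Q := by simp [smul_comp]

/-- Reversal of the coefficients up to `P`, as a linear map. -/
noncomputable def reflectLinear (P : ℕ) : F[X][X] →ₗ[F] F[X][X] where
  toFun Q := Q.reflect P
  map_add' Q R := reflect_add Q R P
  map_smul' e Q := by
    ext1 l
    simp [coeff_reflect]

/-- The linear conditions for passing through a point. -/
noncomputable def pointCondition (P : ℕ) (a : F) (i j : ℕ) : Option F → F[X][X] →ₗ[F] F
  | some c => shiftedCoeff a c i j
  | none => shiftedCoeff a 0 i j ∘ₗ reflectLinear P

theorem passesThrough_of_pointCondition {m P : ℕ} {Q : F[X][X]} {a : F} {y : Option F}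
    (h : ∀ i j, i + j < m → pointCondition P a i j y Q = 0) : PassesThrough m P Q a y := by
  cases y <;> exact h

/-- The polynomial with prescribed coefficients in prescribed positions. -/
noncomputable def coeffLinear (P : ℕ) (N : ℕ → ℕ) :
    ((Σ l : Fin (P + 1), Fin (N l)) → F) →ₗ[F] F[X][X] where
  toFun v := ∑ p : (Σ l : Fin (P + 1), Fin (N l)), monomial p.1 (monomial p.2 (v p))
  map_add' v w := by simp [Finset.sum_add_distrib]
  map_smul' e v := by simp [Finset.smul_sum, smul_monomial]

theorem coeff_coeff_coeffLinear (P : ℕ) (N : ℕ → ℕ)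
    (v : (Σ l : Fin (P + 1), Fin (N l)) → F) (l k : ℕ) :
    ((coeffLinear P N v).coeff l).coeff k =
      if h : ∃ (_ : l < P + 1), k < N l then v ⟨⟨l, h.1⟩, ⟨k, h.2⟩⟩ else 0 := by
  change ((∑ p : (Σ l : Fin (P + 1), Fin (N l)), monomial (p.1 : ℕ)
    (monomial (p.2 : ℕ) (v p))).coeff l).coeff k = _
  rw [finsetSum_coeff, finsetSum_coeff]
  have hterm : ∀ p : (Σ l : Fin (P + 1), Fin (N l)),
      ((monomial (p.1 : ℕ) (monomial (p.2 : ℕ) (v p))).coeff l).coeff k =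
        if (p.1 : ℕ) = l ∧ (p.2 : ℕ) = k then v p else 0 := by
    intro p
    rw [coeff_monomial]
    split_ifs with h1 h2 h2
    · rw [coeff_monomial, if_pos h2.2]
    · rw [coeff_monomial, if_neg fun h3 => h2 ⟨h1, h3⟩]
    · exact absurd h2.1 h1
    · simp
  simp only [hterm]
  split_ifs with h
  · rw [Finset.sum_eq_single ⟨⟨l, h.1⟩, ⟨k, h.2⟩⟩]
    · simp
    · rintro ⟨⟨l', hl'⟩, ⟨k', hk'⟩⟩ _ hne
      rw [if_neg]
      rintro ⟨h1, h2⟩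
      simp only at h1 h2
      subst h1
      subst h2
      exact hne rfl
    · simp
  · refine Finset.sum_eq_zero fun p _ => ?_
    rw [if_neg]
    rintro ⟨h1, h2⟩
    refine h ⟨h1 ▸ p.1.2, ?_⟩
    rw [← h1, ← h2]
    exact p.2.2

theorem two_mul_sum_sub (m : ℕ) : 2 * ∑ j : Fin m, (m - (j : ℕ)) = m * (m + 1) := by
  rw [Fin.sum_univ_eq_sum_range (fun j => m - j) m, ← Finset.sum_range_reflect]
  have : ∀ j ∈ Finset.range m, m - (m - 1 - j) = j + 1 := by
    intro j hj
    rw [Finset.mem_range] at hj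
    omega
  rw [Finset.sum_congr rfl this, Finset.sum_add_distrib, mul_add, mul_comm 2,
    Finset.sum_range_id_mul_two]
  cases m with
  | zero => simp
  | succ m => simp; ring

/-- More coefficients than linear conditions: an interpolant exists. -/
theorem exists_passesThrough {n m P : ℕ} (N : ℕ → ℕ) (a : Fin n → F) (y : Fin n → Option F)
    (h : n * (m * (m + 1)) < 2 * ∑ l ∈ Finset.range (P + 1), N l) :
    ∃ Q : F[X][X], Q ≠ 0 ∧ Q.natDegree ≤ P ∧ (∀ l, Q.coeff l ≠ 0 → (Q.coeff l).natDegree < N l) ∧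
      ∀ i, PassesThrough m P Q (a i) (y i) := by
  let Φ : ((Σ l : Fin (P + 1), Fin (N l)) → F) →ₗ[F]
      ((Fin n × (Σ j : Fin m, Fin (m - j))) → F) :=
    LinearMap.pi fun q => pointCondition P (a q.1) q.2.2 q.2.1 (y q.1) ∘ₗ coeffLinear P N
  have hker : LinearMap.ker Φ ≠ ⊥ := by
    apply LinearMap.ker_ne_bot_of_finrank_lt
    rw [Module.finrank_fintype_fun_eq_card, Module.finrank_fintype_fun_eq_card,
      Fintype.card_prod, Fintype.card_sigma, Fintype.card_sigma]
    simp only [Fintype.card_fin]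
    rw [Fin.sum_univ_eq_sum_range N (P + 1)]
    have := two_mul_sum_sub m
    rw [← this] at h
    have h2 : n * (2 * ∑ j : Fin m, (m - (j : ℕ))) = 2 * (n * ∑ j : Fin m, (m - (j : ℕ))) := by
      ring
    omega
  obtain ⟨v, hv, hv0⟩ := (Submodule.ne_bot_iff _).mp hker
  refine ⟨coeffLinear P N v, ?_, ?_, ?_, ?_⟩
  · intro h0
    apply hv0
    funext ⟨⟨l, hl⟩, ⟨k, hk⟩⟩
    have := coeff_coeff_coeffLinear P N v l k
    rw [dif_pos ⟨hl, hk⟩, h0] at this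
    simpa using this.symm
  · rw [natDegree_le_iff_coeff_eq_zero]
    intro l hl
    ext k
    rw [coeff_coeff_coeffLinear, dif_neg]
    · simp
    · rintro ⟨h1, _⟩
      omega
  · intro l hl
    by_contra hlt
    apply hl
    rw [← leadingCoeff_eq_zero, leadingCoeff, coeff_coeff_coeffLinear, dif_neg]
    rintro ⟨_, h1⟩
    exact hlt h1
  · intro i
    apply passesThrough_of_pointCondition
    intro k j hkj
    have := congrFun (LinearMap.mem_ker.mp hv)
      (i, ⟨⟨j, by omega⟩, ⟨k, by simp only; omega⟩⟩)
    exact this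

/-- The number of monomials of bounded weighted degree. -/
theorem four_mul_sum_ge {D w : ℤ} (hw : Odd w) (P : ℕ) :
    2 * ((P : ℤ) + 1) * (D + 1) - w * P * (P + 1) + P + (D - w * P + 1) % 2 ≤
      4 * ∑ l ∈ Finset.range (P + 1), ((((D - w * l) / 2 + 1).toNat : ℕ) : ℤ) := by
  obtain ⟨v, rfl⟩ := hw
  induction P with
  | zero =>
    simp
    omega
  | succ P ih =>
    rw [Finset.sum_range_succ]
    push_cast at ih ⊢
    -- As `w` is odd, the parity of `D - w l` alternates, so the losses from halving average out.
    -- This yields the summand `P`; the remainder modulo two makes the induction telescope.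
    have key : 2 * (D - (2 * v + 1) * ((P : ℤ) + 1) + 1) + 1
        + (D - (2 * v + 1) * ((P : ℤ) + 1) + 1) % 2 - (D - (2 * v + 1) * P + 1) % 2 ≤
        4 * ((((D - (2 * v + 1) * ((P : ℤ) + 1)) / 2 + 1).toNat : ℕ) : ℤ) := by
      have h1 : (2 * v + 1) * ((P : ℤ) + 1) = (2 * v + 1) * P + 2 * v + 1 := by ring
      rw [h1]
      generalize (2 * v + 1) * (P : ℤ) = z
      omega
    linarith

theorem exists_isInterpolant {n m P : ℕ} {α : F} {s : BerlekampState F} {D : ℤ}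
    (hw : Odd ((s.lenLoc : ℤ) - s.lenX2B))
    (h : 2 * (n : ℤ) * (m * (m + 1)) <
      2 * ((P : ℤ) + 1) * (D + 1) - ((s.lenLoc : ℤ) - s.lenX2B) * P * (P + 1) + P) :
    ∃ Q, IsInterpolant n α s m P Q ∧
      weightedDegree 2 ((s.lenLoc : ℤ) - s.lenX2B) Q ≤ (D : WithBot ℤ) := by
  set w := (s.lenLoc : ℤ) - s.lenX2B
  obtain ⟨Q, h0, hP, hN, hpass⟩ := exists_passesThrough (m := m) (P := P)
    (fun l => ((D - w * l) / 2 + 1).toNat) (fun i : Fin n => α⁻¹ ^ (2 * (i : ℕ)))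
    (fun i => ordinate α s i) (by
      have h1 := four_mul_sum_ge (D := D) hw P
      have h2 := Int.emod_nonneg (D - w * P + 1) two_ne_zero
      zify
      linarith)
  refine ⟨Q, ⟨h0, hP, hpass⟩, ?_⟩
  rw [weightedDegree_le_iff]
  intro l hl
  have := hN l hl
  omega

/-- The weight may be negative, but the bound on the `y`-degree keeps weighted degrees above `-|w|
P`. -/
theorem exists_isMinInterpolant {n m P : ℕ} {α : F} {s : BerlekampState F}
    (h : ∃ Q, IsInterpolant n α s m P Q) : ∃ Q, IsMinInterpolant n α s m P Q := by
  set w := (s.lenLoc : ℤ) - s.lenX2B with hw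
  have hval : ∀ Q, IsInterpolant n α s m P Q →
      ∃ z : ℤ, weightedDegree 2 w Q = z ∧ -(|w| * P) ≤ z := by
    intro Q hQ
    have hl : Q.coeff Q.natDegree ≠ 0 := by
      rw [coeff_natDegree, Ne, leadingCoeff_eq_zero]
      exact hQ.1
    have hle : ((2 * ((Q.coeff Q.natDegree).natDegree : ℤ) + w * (Q.natDegree : ℤ) : ℤ) :
        WithBot ℤ) ≤ weightedDegree 2 w Q :=
      Finset.le_sup (f := fun l => ((2 * ((Q.coeff l).natDegree : ℤ) + w * (l : ℤ) : ℤ) :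
        WithBot ℤ)) (mem_support_iff.mpr hl)
    obtain ⟨z, hz⟩ := WithBot.ne_bot_iff_exists.mp
      (ne_of_gt ((WithBot.bot_lt_coe _).trans_le hle))
    refine ⟨z, hz.symm, ?_⟩
    rw [← hz, WithBot.coe_le_coe] at hle
    have h1 : |w * (Q.natDegree : ℤ)| ≤ |w| * P := by
      rw [abs_mul, Nat.abs_cast]
      exact mul_le_mul_of_nonneg_left (by exact_mod_cast hQ.2.1) (abs_nonneg w)
    have h2 := (abs_le.mp h1).1
    linarith [(Q.coeff Q.natDegree).natDegree.cast_nonneg (α := ℤ)]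
  obtain ⟨Q₀, hQ₀⟩ := h
  obtain ⟨z₀, hz₀, -⟩ := hval Q₀ hQ₀
  obtain ⟨z, ⟨Q, hQ, hz⟩, hmin⟩ := Int.exists_least_of_bdd
    (P := fun z => ∃ Q, IsInterpolant n α s m P Q ∧ weightedDegree 2 w Q = z)
    ⟨-(|w| * P), by
      rintro z ⟨Q, hQ, hz⟩
      obtain ⟨z', hz', hle⟩ := hval Q hQ
      rw [hz, WithBot.coe_inj] at hz'
      rwa [hz']⟩
    ⟨z₀, Q₀, hQ₀, hz₀⟩
  refine ⟨Q, hQ, fun Q' hQ' => ?_⟩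
  obtain ⟨z', hz', -⟩ := hval Q' hQ'
  rw [← hw, hz, hz', WithBot.coe_le_coe]
  exact hmin z' ⟨Q', hQ', hz'⟩

/-! ### The parameters -/

theorem quadratic_of_lt {n d t : ℕ}
    (ht : (t : ℝ) < ((n : ℝ) - Real.sqrt ((n : ℝ) * ((n : ℝ) - 2 * (d : ℝ)))) / 2) :
    2 * (t : ℝ) < n ∧ 0 < (t : ℝ) ^ 2 - n * ((t : ℝ) - (d : ℝ) / 2) := by
  have h1 := Real.sqrt_nonneg ((n : ℝ) * ((n : ℝ) - 2 * (d : ℝ)))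
  have h2 : Real.sqrt ((n : ℝ) * ((n : ℝ) - 2 * (d : ℝ))) < n - 2 * t := by linarith
  have h3 : (0 : ℝ) < n - 2 * t := by linarith
  rw [Real.sqrt_lt' h3] at h2
  exact ⟨by linarith, by nlinarith⟩

/-- The quadratic decreases for `t < n/2`, and its value `d (d - n/2)` at `t = d` is not positive.
-/
theorem lt_of_quadratic {n d t : ℕ} (hdn : 2 * d ≤ n) (h1 : 2 * (t : ℝ) < n)
    (h2 : 0 < (t : ℝ) ^ 2 - n * ((t : ℝ) - (d : ℝ) / 2)) : t < d := by
  have h3 : 2 * (d : ℝ) ≤ n := by exact_mod_cast hdn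
  by_contra hlt
  have h4 : (d : ℝ) ≤ t := by exact_mod_cast not_lt.mp hlt
  have h5 : (0 : ℝ) ≤ d := Nat.cast_nonneg d
  nlinarith [mul_nonneg (sub_nonneg.mpr h4) (sub_nonneg.mpr h3)]

/-- From `t ≤ d` follows `t - t₀ ≤ t/2`. The bound makes errors of weight below `t` no harder than
those of weight `t`. -/
theorem two_mul_le_yDegree {d t m : ℕ} (hdt : d < 2 * t) (htd : t ≤ d) :
    2 * m ≤ yDegree d t m := by
  have h1 : (d : ℝ) < 2 * t := by exact_mod_cast hdt
  have h2 : (t : ℝ) ≤ d := by exact_mod_cast htd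
  have h3 : (0 : ℝ) ≤ m := Nat.cast_nonneg m
  apply Nat.le_floor
  rw [le_div_iff₀ (by linarith)]
  push_cast
  nlinarith

/-- Undoing the completed square and clearing denominators gives the integral form needed for
counting. -/
theorem FreedomConstraint.lt {n d t m : ℕ} (hdt : d < 2 * t) (h : FreedomConstraint n d t m) :
    2 * (n : ℤ) * (m * (m + 1)) < ((yDegree d t m : ℤ) + 1) *
      (4 * t * m - yDegree d t m * (2 * t - d)) + yDegree d t m := by
  have h1 : (d : ℝ) < 2 * t := by exact_mod_cast hdt
  unfold FreedomConstraint at h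
  set P := yDegree d t m
  set A : ℝ := (t : ℝ) - (d : ℝ) / 2 with hA
  have hA0 : A ≠ 0 := by
    intro h0
    linarith
  have h2 : -(A / 2) * ((P : ℝ) - (2 * t * m - t + (d : ℝ) / 2 + 1 / 2) / (2 * A)) ^ 2
      + (2 * t * m - t + (d : ℝ) / 2 + 1 / 2) ^ 2 / (8 * A) + t * m =
      (((P : ℝ) + 1) * (4 * t * m - P * (2 * t - d)) + P) / 4 := by
    have hd : (d : ℝ) = 2 * t - 2 * A := by rw [hA]; ring
    rw [hd]
    field_simp
    ring
  rw [h2] at h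
  have h3 : 2 * (n : ℝ) * (m * (m + 1)) < ((P : ℝ) + 1) * (4 * t * m - P * (2 * t - d)) + P := by
    linarith
  exact_mod_cast h3

/-- The floor puts `P_y` within `1/2` of the vertex of the quadratic, which costs at most `(t -
t₀)/8`. The rest is positive because `(m + 1)(t² - n (t - t₀)) > t t₀` and `m ≥ 1`. -/
theorem FreedomConstraint.of_multiplicityBound {n d t : ℕ} (hdt : d < 2 * t)
    (h1 : 2 * (t : ℝ) < n) (h2 : 0 < (t : ℝ) ^ 2 - n * ((t : ℝ) - (d : ℝ) / 2)) :
    FreedomConstraint n d t (multiplicityBound n d t) := by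
  have hdt' : (d : ℝ) < 2 * t := by exact_mod_cast hdt
  have ht0 : (0 : ℝ) ≤ t := Nat.cast_nonneg t
  have hd0 : (0 : ℝ) ≤ d := Nat.cast_nonneg d
  set m := multiplicityBound n d t with hm
  set A : ℝ := (t : ℝ) - (d : ℝ) / 2 with hA
  set E : ℝ := (t : ℝ) ^ 2 - n * A with hE
  have hA0 : 0 < A := by linarith
  have hd : (d : ℝ) / 2 = t - A := by rw [hA]; ring
  have hm1 : (t : ℝ) * (t - A) < (m + 1) * E := by
    have := Nat.lt_floor_add_one (((t : ℝ) * ((d : ℝ) / 2)) / E)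
    rw [div_lt_iff₀ h2] at this
    rw [← hd]
    exact this
  have hm2 : 1 ≤ (m : ℝ) := by
    have : 1 ≤ m := by
      apply Nat.le_floor
      rw [← hA, ← hE, hd, le_div_iff₀ h2]
      push_cast
      nlinarith
    exact_mod_cast this
  have hP1 : (yDegree d t m : ℝ) ≤ ((t : ℝ) * m + 1 / 4) / A :=
    Nat.floor_le (by positivity)
  have hP2 : ((t : ℝ) * m + 1 / 4) / A < yDegree d t m + 1 := Nat.lt_floor_add_one _
  unfold FreedomConstraint
  set P := yDegree d t m
  rw [← hA]
  have hK : 2 * (t : ℝ) * m - t + (d : ℝ) / 2 + 1 / 2 = 2 * t * m - A + 1 / 2 := by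
    rw [hd]; ring
  rw [hK]
  have hc : (2 * (t : ℝ) * m - A + 1 / 2) / (2 * A) = ((t : ℝ) * m + 1 / 4) / A - 1 / 2 := by
    field_simp
    ring
  have hsq : ((P : ℝ) - (2 * (t : ℝ) * m - A + 1 / 2) / (2 * A)) ^ 2 ≤ 1 / 4 := by
    rw [hc]
    nlinarith
  have hmain : (n : ℝ) * m * (m + 1) / 2 <
      -(A / 8) + (2 * (t : ℝ) * m - A + 1 / 2) ^ 2 / (8 * A) + t * m := by
    have h5 : -(A / 8) + (2 * (t : ℝ) * m - A + 1 / 2) ^ 2 / (8 * A) + t * m -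
        (n : ℝ) * m * (m + 1) / 2 =
        (4 * m * ((m + 1) * E - t * (t - A)) + (2 * t * m + 1 / 4 - A)) / (8 * A) := by
      rw [hE]
      field_simp
      ring
    have h6 : 0 < 4 * (m : ℝ) * ((m + 1) * E - t * (t - A)) + (2 * t * m + 1 / 4 - A) := by
      have h7 : 0 ≤ 4 * (m : ℝ) * ((m + 1) * E - t * (t - A)) :=
        mul_nonneg (by positivity) (by linarith)
      have h8 : (t : ℝ) ≤ t * m := le_mul_of_one_le_right ht0 hm2
      linarith
    have := div_pos h6 (show 0 < 8 * A by positivity)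
    linarith
  have h9 : -(A / 2) * ((P : ℝ) - (2 * (t : ℝ) * m - A + 1 / 2) / (2 * A)) ^ 2 ≥ -(A / 8) := by
    nlinarith
  linarith

end

section

variable {F : Type*} [Field F]

/-! ### Recovering the error locator -/

theorem coeff_seqPoly (l : List F) (k : ℕ) :
    (seqPoly l).coeff k = if k < l.length then l.getD k 0 else 0 := by
  rw [seqPoly, finsetSum_coeff]
  simp only [coeff_C_mul_X_pow]
  rw [Finset.sum_ite_eq]
  simp

/-- A reduced fraction `b / λ` is recovered from the prefix of its power series. -/
theorem candidateLocator_eq {t : ℕ} {s : BerlekampState F} {lam b : F[X]} {σ : F⟦X⟧}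
    (hσ : (lam : F⟦X⟧) * σ = b) (h0 : lam.coeff 0 = 1) (hcop : IsCoprime lam b)
    (hlam : 2 * lam.natDegree + s.lenLoc ≤ t) (hb : 2 * b.natDegree + s.lenX2B ≤ t) :
    candidateLocator t s
      ((List.range ((t - s.lenX2B + 1) + 2 * (t - s.lenLoc))).map
        fun i => PowerSeries.coeff i σ) =
      lam.comp (X ^ 2) * s.loc + b.comp (X ^ 2) * s.x2B := by
  unfold candidateLocator
  set J := t - s.lenX2B + 1 with hJ
  set N := 2 * (t - s.lenLoc) with hN
  set l := (List.range (J + N)).map fun i => PowerSeries.coeff i σ with hl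
  have hlen : l.length = J + N := by simp [hl]
  have hget : ∀ i < J + N, l.getD i 0 = PowerSeries.coeff i σ := by
    intro i hi
    rw [List.getD_eq_getElem _ _ (by omega)]
    simp [hl]
  have hbJ : b.degree < ((J : ℕ) : WithBot ℕ) := by
    refine lt_of_le_of_lt degree_le_natDegree ?_
    rw [Nat.cast_lt]
    omega
  -- The terms from index `J > deg b` onwards are the series of a proper fraction `τ/λ`, again
  -- reduced.
  obtain ⟨τ, hτ⟩ : X ^ J ∣ b - lam * PowerSeries.trunc J σ := by
    apply X_pow_dvd_of_coe
    have h1 : ((b - lam * PowerSeries.trunc J σ : F[X]) : F⟦X⟧) =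
        (lam : F⟦X⟧) * (σ - ((PowerSeries.trunc J σ : F[X]) : F⟦X⟧)) := by
      rw [Polynomial.coe_sub, Polynomial.coe_mul, ← hσ]
      ring
    rw [h1]
    refine Dvd.dvd.mul_left ?_ _
    rw [PowerSeries.X_pow_dvd_iff]
    intro i hi
    rw [map_sub, Polynomial.coeff_coe, PowerSeries.coeff_trunc, if_pos hi, sub_self]
  have hτdeg : τ.degree < lam.natDegree := by
    rw [degree_lt_iff_coeff_zero]
    intro i hi
    have h1 : (X ^ J * τ).degree < ((lam.natDegree + J : ℕ) : WithBot ℕ) := by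
      rw [← hτ]
      refine (degree_sub_le _ _).trans_lt (max_lt (hbJ.trans_le ?_)
        (degree_mul_lt le_rfl (PowerSeries.degree_trunc_lt _ _)))
      rw [Nat.cast_le]
      omega
    rw [← coeff_X_pow_mul τ J i]
    exact (degree_lt_iff_coeff_zero _ _).mp h1 _ (by omega)
  have hcop' : IsCoprime lam τ := by
    have h1 : IsCoprime lam (X ^ J * τ) := by
      rw [← hτ, sub_eq_add_neg, ← mul_neg]
      exact IsCoprime.add_mul_left_right hcop _
    exact h1.of_mul_right_right
  have hkey : PowerSeries.X ^ N ∣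
      (lam : F⟦X⟧) * PowerSeries.mk (fun j => l.getD (J + j) 0) - (τ : F⟦X⟧) := by
    set w : F⟦X⟧ := PowerSeries.mk fun j => PowerSeries.coeff (J + j) σ with hw
    have h1 : σ = ((PowerSeries.trunc J σ : F[X]) : F⟦X⟧) + PowerSeries.X ^ J * w := by
      ext i
      rw [map_add, Polynomial.coeff_coe, PowerSeries.coeff_trunc, PowerSeries.coeff_X_pow_mul']
      rcases lt_or_ge i J with hi | hi
      · rw [if_pos hi, if_neg (by omega), add_zero]
      · rw [if_neg (by omega), if_pos hi, zero_add, hw, PowerSeries.coeff_mk,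
          Nat.add_sub_cancel' hi]
    have h2 : (lam : F⟦X⟧) * w = τ := by
      apply mul_left_cancel₀ (pow_ne_zero J (PowerSeries.X_ne_zero (R := F)))
      have h3 := congrArg (fun q : F[X] => (q : F⟦X⟧)) hτ
      simp only [Polynomial.coe_sub, Polynomial.coe_mul, Polynomial.coe_pow,
        Polynomial.coe_X] at h3
      linear_combination h3 + hσ - (lam : F⟦X⟧) * h1
    rw [← h2, ← mul_sub]
    refine Dvd.dvd.mul_left ?_ _
    rw [PowerSeries.X_pow_dvd_iff]
    intro i hi
    rw [map_sub, PowerSeries.coeff_mk, PowerSeries.coeff_mk, hget _ (by omega), sub_self]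
  have hBM := berlekampMassey_loc_eq hτdeg h0 (by omega : 2 * lam.natDegree ≤ N) hcop' hkey
  have hmod : (seqPoly l * lam) %ₘ (X ^ J) = b := by
    have h1 : X ^ J ∣ seqPoly l * lam - b := by
      apply X_pow_dvd_of_coe
      have h2 : ((seqPoly l * lam - b : F[X]) : F⟦X⟧) =
          (lam : F⟦X⟧) * ((seqPoly l : F⟦X⟧) - σ) := by
        rw [Polynomial.coe_sub, Polynomial.coe_mul, ← hσ]
        ring
      rw [h2]
      refine Dvd.dvd.mul_left ?_ _
      rw [PowerSeries.X_pow_dvd_iff]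
      intro i hi
      rw [map_sub, Polynomial.coeff_coe, coeff_seqPoly, hlen, if_pos (by omega),
        hget _ (by omega), sub_self]
    rw [modByMonic_eq_of_dvd_sub (monic_X_pow J) h1,
      modByMonic_eq_self_iff (monic_X_pow J), degree_X_pow]
    exact hbJ
  simp only [hBM, hmod]

theorem coeff_zero_comp_X_sq (p : F[X]) : (p.comp (X ^ 2)).coeff 0 = p.coeff 0 := by
  rw [coeff_zero_eq_eval_zero, eval_comp, coeff_zero_eq_eval_zero]
  simp

/-! ### The reduced fraction of a separable solution -/

section Fractions

variable [CharP F 2]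

/-- A common factor `g` gives a factor `g(x²)`, whose derivative is zero; separability makes it a
unit. -/
theorem isCoprime_of_separable {lam b p q : F[X]}
    (h : (lam.comp (X ^ 2) * p + b.comp (X ^ 2) * q).Separable) : IsCoprime lam b := by
  classical
  rw [← EuclideanDomain.gcd_isUnit_iff]
  set g := EuclideanDomain.gcd lam b with hg
  obtain ⟨l', hl'⟩ := EuclideanDomain.gcd_dvd_left lam b
  obtain ⟨b', hb'⟩ := EuclideanDomain.gcd_dvd_right lam b
  have h1 : lam.comp (X ^ 2) * p + b.comp (X ^ 2) * q =
      g.comp (X ^ 2) * (l'.comp (X ^ 2) * p + b'.comp (X ^ 2) * q) := by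
    rw [← hg] at hl' hb'
    conv_lhs => rw [hl', hb']
    rw [mul_comp, mul_comp]
    ring
  rw [h1] at h
  have h2 := h.of_mul_left
  rw [Separable, derivative_comp_X_sq, isCoprime_zero_right] at h2
  have h3 := natDegree_eq_zero_of_isUnit h2
  rw [natDegree_comp, natDegree_X_pow] at h3
  have h4 : g.natDegree = 0 := by omega
  rw [eq_C_of_natDegree_eq_zero h4] at h2 ⊢
  rwa [C_comp] at h2

theorem BerlekampInvariant.exists_fraction {S : ℕ → F} {k : ℕ} {s : BerlekampState F}
    (h : BerlekampInvariant S k s) {V : F[X]} (hV : KeyEquation S k V) (hsep : V.Separable)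
    (h0 : V.coeff 0 = 1) :
    ∃ lam b : F[X], V = lam.comp (X ^ 2) * s.loc + b.comp (X ^ 2) * s.x2B ∧
      lam.coeff 0 = 1 ∧ IsCoprime lam b ∧ 2 * lam.natDegree + s.lenLoc ≤ V.natDegree ∧
      (b ≠ 0 → 2 * b.natDegree + s.lenX2B ≤ V.natDegree) ∧ (b = 0 → V = s.loc) := by
  obtain ⟨lam, b, hVeq, hlam, hb⟩ := h.exists_eq_comp_mul_add hV
  have hlam0 : lam.coeff 0 = 1 := by
    rw [hVeq, coeff_add, mul_coeff_zero, mul_coeff_zero, h.loc_zero, h.x2B_zero,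
      coeff_zero_comp_X_sq] at h0
    simpa using h0
  have hne : lam ≠ 0 := by
    rintro rfl
    simp at hlam0
  have hcop : IsCoprime lam b := isCoprime_of_separable (hVeq ▸ hsep)
  refine ⟨lam, b, hVeq, hlam0, hcop, hlam hne, hb, ?_⟩
  rintro rfl
  rw [isCoprime_zero_right] at hcop
  have h1 := natDegree_eq_zero_of_isUnit hcop
  rw [eq_C_of_natDegree_eq_zero h1, hlam0] at hVeq
  simpa using hVeq

end Fractions

variable [Algebra (ZMod 2) F] {n : ℕ}

theorem injective_pow_two_mul {α : F} (hα : n ≤ orderOf α) :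
    Function.Injective fun i : Fin n => α⁻¹ ^ (2 * (i : ℕ)) := by
  have : CharP F 2 := charP_two_of_algebra
  intro i j h
  apply injective_pow_of_le_orderOf hα
  simp only [inv_pow, inv_inj] at h ⊢
  rw [mul_comm 2, mul_comm 2, pow_mul, pow_mul] at h
  exact CharTwo.sq_injective h

/-- The interpolation polynomial vanishes on every fraction that belongs to a codeword. -/
theorem homogEval_eq_zero {α : F} (hα : n ≤ orderOf α) (hα0 : α ≠ 0) {S : ℕ → F} {k : ℕ}
    {s : BerlekampState F} (h : BerlekampInvariant S k s) {t m P : ℕ} (hP : 2 * m ≤ P)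
    {Q : F[X][X]} (hQ : IsInterpolant n α s m P Q)
    (hdeg : weightedDegree 2 ((s.lenLoc : ℤ) - s.lenX2B) Q ≤
      ((2 * t * m - 1 - P * (t - s.lenLoc) : ℤ) : WithBot ℤ))
    {E : Finset (Fin n)} (hE : E.card ≤ t) {lam b : F[X]} (hlam : lam ≠ 0) (hb : b ≠ 0)
    (hV : locator (fun i : Fin n => α ^ (i : ℕ)) E =
      lam.comp (X ^ 2) * s.loc + b.comp (X ^ 2) * s.x2B)
    (hlamdeg : 2 * lam.natDegree + s.lenLoc ≤ E.card)
    (hbdeg : 2 * b.natDegree + s.lenX2B ≤ E.card) : homogEval P Q b lam = 0 := by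
  have : CharP F 2 := charP_two_of_algebra
  apply eq_zero_of_X_sub_C_pow_dvd (injective_pow_two_mul hα).injOn (E := E) (m := m)
  · intro i hi
    set z := α⁻¹ ^ (i : ℕ) with hz
    have hz0 : z ≠ 0 := pow_ne_zero _ (inv_ne_zero hα0)
    have hz2 : α⁻¹ ^ (2 * (i : ℕ)) = z ^ 2 := by rw [hz, ← pow_mul, mul_comm]
    have hVz : lam.eval (z ^ 2) * s.loc.eval z + b.eval (z ^ 2) * s.x2B.eval z = 0 := by
      have h1 : (locator (fun i : Fin n => α ^ (i : ℕ)) E).eval z = 0 := by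
        rw [eval_locator_eq_zero_iff]
        exact ⟨i, hi, by rw [hz, inv_pow, mul_inv_cancel₀ (pow_ne_zero _ hα0)]⟩
      rw [hV] at h1
      simpa [eval_comp] using h1
    refine (hQ.2.2 i).X_sub_C_pow_dvd_homogEval hQ.2.1 hlam hb ?_ ?_
    · intro c hc
      rw [hz2]
      unfold ordinate at hc
      split_ifs at hc with hx
      rw [← hz] at hx hc
      rw [← Option.some_inj.mp hc]
      field_simp
      linear_combination hVz
    · intro hnone
      unfold ordinate at hnone
      split_ifs at hnone with hx
      rw [← hz] at hx
      rw [hz2]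
      rw [hx, mul_zero, add_zero] at hVz
      exact (mul_eq_zero.mp hVz).resolve_right (h.eval_loc_ne_zero hz0 hx)
  · intro hne
    have h1 := two_mul_natDegree_homogEval_le (e := (E.card : ℤ)) (L₁ := s.lenLoc)
      (L₂ := s.lenX2B) (weightedDegree_le_iff.mp hdeg) (by exact_mod_cast hlamdeg)
      (by exact_mod_cast hbdeg) hne
    -- Twice the degree is at most `2tm - 1 - P (t - |E|)`, and `P ≥ 2m` brings this down to `2m|E|
    -- - 1`.
    have h2 : (0 : ℤ) ≤ ((P : ℤ) - 2 * m) * (t - E.card) :=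
      mul_nonneg (by rw [sub_nonneg]; exact_mod_cast hP)
        (by rw [sub_nonneg]; exact_mod_cast hE)
    zify
    nlinarith

/-- Soundness: any `λ` with constant coefficient one and any `b` give a solution of the key
equation, so nothing about `Q` is needed. -/
theorem mem_bchCode_of_mem_listFromInterpolant [Fintype F] {α : F} (hα : n ≤ orderOf α)
    (hα0 : α ≠ 0) {r c : Fin n → ZMod 2} {k t : ℕ} {s : BerlekampState F}
    (h : BerlekampInvariant (syndrome α r) k s) {Q : F[X][X]}
    (hc : c ∈ listFromInterpolant α t r s Q) :
    c ∈ bchCode n (2 * k + 1) α ∧ hammingDist r c ≤ t := by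
  have : CharP F 2 := charP_two_of_algebra
  rw [listFromInterpolant, Finset.mem_filter, Finset.mem_union, Finset.mem_biUnion] at hc
  refine ⟨?_, hc.2⟩
  rcases hc.1 with h1 | ⟨l, -, h1⟩
  · exact mem_bchCode_of_mem_candidate hα hα0 h.loc_key h.loc_zero h.natDegree_loc h1
  · refine mem_bchCode_of_mem_candidate hα hα0 ?_ ?_ le_rfl h1
    · exact (h.loc_key.comp_mul _).add (h.x2B_key.comp_mul _)
    · simp only [candidateLocator]
      rw [coeff_add, mul_coeff_zero, mul_coeff_zero, h.loc_zero, h.x2B_zero,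
        coeff_zero_comp_X_sq, coeff_zero_berlekampMassey]
      simp

theorem exists_fraction_of_mem_bchCode {α : F} (hα : n ≤ orderOf α) (hα0 : α ≠ 0)
    {r : Fin n → ZMod 2} {E : Finset (Fin n)} {k : ℕ} {s : BerlekampState F}
    (h : BerlekampInvariant (syndrome α r) k s) (hc : flip r E ∈ bchCode n (2 * k + 1) α) :
    ∃ lam b : F[X], locator (fun i : Fin n => α ^ (i : ℕ)) E =
        lam.comp (X ^ 2) * s.loc + b.comp (X ^ 2) * s.x2B ∧
      lam.coeff 0 = 1 ∧ IsCoprime lam b ∧ 2 * lam.natDegree + s.lenLoc ≤ E.card ∧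
      (b ≠ 0 → 2 * b.natDegree + s.lenX2B ≤ E.card) ∧
      (b = 0 → flip r E ∈ candidate α r s.loc s.lenLoc) := by
  have : CharP F 2 := charP_two_of_algebra
  have hdeg : (locator (fun i : Fin n => α ^ (i : ℕ)) E).natDegree = E.card :=
    natDegree_locator fun i _ => pow_ne_zero _ hα0
  obtain ⟨lam, b, h1, h2, h3, h4, h5, h6⟩ := h.exists_fraction (keyEquation_of_flip_mem hc)
    (separable_locator (injective_pow_of_le_orderOf hα).injOn) (locator_coeff_zero _ _)
  rw [hdeg] at h4 h5
  refine ⟨lam, b, h1, h2, h3, h4, h5, fun hb => ?_⟩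
  have h7 := h6 hb
  have h8 : s.lenLoc = E.card := by
    have := h.natDegree_loc
    rw [← h7, hdeg] at this
    omega
  rw [← h7, h8]
  exact mem_candidate_locator hα hα0 r E

theorem mem_listFromInterpolant [Fintype F] {α : F} (hα : n ≤ orderOf α) (hα0 : α ≠ 0)
    {r : Fin n → ZMod 2} {E : Finset (Fin n)} {k t m P : ℕ} {s : BerlekampState F}
    (h : BerlekampInvariant (syndrome α r) k s) (hP : 2 * m ≤ P)
    {Q : F[X][X]} (hQ : IsInterpolant n α s m P Q)
    (hdeg : weightedDegree 2 ((s.lenLoc : ℤ) - s.lenX2B) Q ≤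
      ((2 * t * m - 1 - P * (t - s.lenLoc) : ℤ) : WithBot ℤ))
    (hE : E.card ≤ t) (hc : flip r E ∈ bchCode n (2 * k + 1) α) :
    flip r E ∈ listFromInterpolant α t r s Q := by
  obtain ⟨lam, b, hV, hlam0, hcop, hlam, hb, hzero⟩ :=
    exists_fraction_of_mem_bchCode hα hα0 h hc
  rw [listFromInterpolant, Finset.mem_filter, Finset.mem_union, Finset.mem_biUnion]
  refine ⟨?_, by rwa [hammingDist_flip]⟩
  by_cases hb0 : b = 0
  · exact Or.inl (hzero hb0)
  right
  have hlamne : lam ≠ 0 := by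
    rintro rfl
    simp at hlam0
  have hvanish := homogEval_eq_zero hα hα0 h hP hQ hdeg hE hlamne hb0 hV hlam (hb hb0)
  set σ : F⟦X⟧ := (b : F⟦X⟧) * (lam : F⟦X⟧)⁻¹ with hσdef
  have hσ : (lam : F⟦X⟧) * σ = b := by
    rw [hσdef, mul_left_comm, PowerSeries.mul_inv_cancel, mul_one]
    simp [hlam0]
  have hroot : eval₂ coeToPowerSeries.ringHom σ Q = 0 := by
    have h1 := map_homogEval coeToPowerSeries.ringHom hQ.2.1 (b := b) (lam := lam) (y := σ)
      (by simpa [mul_comm] using hσ.symm)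
    rw [hvanish, map_zero, eq_comm, mul_eq_zero] at h1
    refine h1.resolve_left (pow_ne_zero _ ?_)
    simpa using hlamne
  refine ⟨_, mem_rationalFactorization _ hroot, ?_⟩
  rw [candidateLocator_eq hσ hlam0 hcop (hlam.trans hE) ((hb hb0).trans hE), ← hV,
    natDegree_locator fun i _ => pow_ne_zero _ hα0]
  exact mem_candidate_locator hα hα0 r E

end

/-! ### The interpolant of step 4 and the conclusion -/

section

variable {F : Type*} [Field F]

/-- In step 4 an interpolant of the required weighted degree exists. -/
theorem exists_isInterpolant_le {n k t m : ℕ} {α : F} {s : BerlekampState F}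
    (hlen : s.lenLoc + s.lenX2B = 2 * k + 1) (hkt : 2 * k + 1 < 2 * t)
    (hm : FreedomConstraint n (2 * k + 1) t m) :
    ∃ Q, IsInterpolant n α s m (yDegree (2 * k + 1) t m) Q ∧
      weightedDegree 2 ((s.lenLoc : ℤ) - s.lenX2B) Q ≤
        ((2 * t * m - 1 - yDegree (2 * k + 1) t m * (t - s.lenLoc) : ℤ) : WithBot ℤ) := by
  have hx : (s.lenX2B : ℤ) = 2 * k + 1 - s.lenLoc := by
    have : (s.lenLoc : ℤ) + s.lenX2B = 2 * k + 1 := by exact_mod_cast hlen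
    linarith
  apply exists_isInterpolant
  · exact ⟨s.lenLoc - k - 1, by rw [hx]; ring⟩
  -- For this degree bound the terms with `L_Λ` cancel, leaving the freedom constraint.
  · have h1 := hm.lt hkt
    rw [hx]
    push_cast at h1
    linarith

end

end BCHListDecoding

open BCHListDecoding in
theorem theorem5 {F : Type*} [Field F] [Fintype F] [Algebra (ZMod 2) F]
    (n d t m : ℕ) (α : F) (hα : n ≤ orderOf α) (hd : Odd d) (hdn : 2 * d ≤ n)
    (ht : (t : ℝ) < ((n : ℝ) - Real.sqrt ((n : ℝ) * ((n : ℝ) - 2 * (d : ℝ)))) / 2)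
    (hm : m = BCHListDecoding.multiplicityBound n d t ∨
      BCHListDecoding.FreedomConstraint n d t m)
    (r : Fin n → ZMod 2) :
    (∃ out, BCHListDecoding.IsOutput α d t m r out) ∧
    ∀ out, BCHListDecoding.IsOutput α d t m r out →
      ∀ c : Fin n → ZMod 2,
        c ∈ out ↔ c ∈ BCHListDecoding.bchCode n d α ∧ hammingDist r c ≤ t := by
  obtain ⟨k, rfl⟩ := hd
  have hα0 : α ≠ 0 := by
    rintro rfl
    rw [orderOf_zero] at hα
    omega
  have : CharP F 2 := charP_two_of_algebra
  have hs : berlekamp (syndrome α r) (2 * k + 1) = berlekampIter (syndrome α r) k := by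
    rw [berlekamp]
    congr 1
    omega
  have hinv := berlekampInvariant_iter (syndrome α r) k
  rw [← hs] at hinv
  set s := berlekamp (syndrome α r) (2 * k + 1) with hsdef
  have hlen := hinv.len_add
  obtain ⟨hq1, hq2⟩ := quadratic_of_lt ht
  have htd := lt_of_quadratic hdn hq1 hq2
  -- Both lengths at most `t`, with odd sum `d`, force `d < 2t`.
  have hfree : s.lenLoc ≤ t → s.lenX2B ≤ t → FreedomConstraint n (2 * k + 1) t m := by
    intro h1 h2
    rcases hm with rfl | hm
    · exact FreedomConstraint.of_multiplicityBound (by omega) hq1 hq2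
    · exact hm
  constructor
  · by_cases h1 : s.lenLoc ≤ t
    · by_cases h2 : s.lenX2B ≤ t
      · obtain ⟨Q, hQ, -⟩ := exists_isInterpolant_le (α := α) hlen (by omega) (hfree h1 h2)
        obtain ⟨Q', hQ'⟩ := exists_isMinInterpolant ⟨Q, hQ⟩
        exact ⟨_, Or.inr (Or.inr ⟨h1, h2, Q', hQ', rfl⟩)⟩
      · exact ⟨_, Or.inr (Or.inl ⟨h1, not_le.mp h2, rfl⟩)⟩
    · exact ⟨_, Or.inl ⟨not_le.mp h1, rfl⟩⟩
  · intro out hout c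
    obtain ⟨E, rfl⟩ : ∃ E, flip r E = c := ⟨_, flip_filter_ne r c⟩
    rcases hout with ⟨h1, rfl⟩ | ⟨h1, h2, rfl⟩ | ⟨h1, h2, Q, hQ, rfl⟩
    · change t < s.lenLoc at h1
      simp only [Finset.notMem_empty, false_iff, not_and, hammingDist_flip]
      intro hc hE
      obtain ⟨lam, b, -, -, -, hlam, -⟩ := exists_fraction_of_mem_bchCode hα hα0 hinv hc
      omega
    · change t < s.lenX2B at h2
      constructor
      · intro hc
        refine ⟨mem_bchCode_of_mem_candidate hα hα0 hinv.loc_key hinv.loc_zero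
          hinv.natDegree_loc hc, ?_⟩
        rw [mem_candidate_iff] at hc
        rw [hc.2, hammingDist_flip, hc.1]
        exact h1
      · rintro ⟨hc, hE⟩
        rw [hammingDist_flip] at hE
        obtain ⟨lam, b, -, -, -, -, hb, hzero⟩ :=
          exists_fraction_of_mem_bchCode hα hα0 hinv hc
        -- A nonzero `b` would need at least `L_{x²B} > t` errors.
        apply hzero
        by_contra hb0
        have := hb hb0
        omega
    · change s.lenLoc ≤ t at h1
      change s.lenX2B ≤ t at h2
      constructor
      · exact mem_bchCode_of_mem_listFromInterpolant hα hα0 hinv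
      · rintro ⟨hc, hE⟩
        rw [hammingDist_flip] at hE
        obtain ⟨Q', hQ', hdeg⟩ :=
          exists_isInterpolant_le (α := α) hlen (by omega) (hfree h1 h2)
        exact mem_listFromInterpolant hα hα0 hinv (two_mul_le_yDegree (by omega) htd.le) hQ.1
          ((hQ.2 Q' hQ').trans hdeg) hE hc
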